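/- Let $l\ge 1$, let $K_l$ be the $l$-Kronecker quiver (vertices $1,2$ and $l$ arrows $1\to 2$), let $\mathrm{mod}\,\mathbb{C}K_l$ be the category of finitely generated modules over its path algebra, and $\mathcal{D}=\mathcal{D}^b(\mathrm{mod}\,\mathbb{C}K_l)$ its bounded derived category, with Grothendieck group $K(\mathcal{D})$. Fix a norm on $K(\mathcal{D})\otimes_{\mathbb{Z}}\mathbb{R}$. Let $\mathrm{Stab}_K(\mathcal{D})$ be the space of Bridgeland stability conditions $\sigma=(Z,\mathcal{P})$ on $\mathcal{D}$ with central charge $Z:K(\mathcal{D})\to\mathbb{C}$ that have the support property ($\|[E]\|<C\,|Z(E)|$ for some $C>0$ and all $0\ne E\in\mathcal P(\phi)$, $\phi\in\mathbb{R}$), with the generalized metric $$d_B(\sigma,\tau)=\sup_{0\ne E\in\mathcal{D}}\Big\{|\phi^+_\sigma(E)-\phi^+_\tau(E)|,\ |\phi^-_\sigma(E)-\phi^-_\tau(E)|,\ \Big|\log\frac{m_\sigma(E)}{m_\tau(E)}\Big|\Big\}\in[0,\infty]$$ and the topology it induces. Here $\phi^+_\sigma(E)$ and $\phi^-_\sigma(E)$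 are the phases of the first and the last semistable factor in the Harder--Narasimhan filtration of $E$, and $m_\sigma(E)=\sum_i|Z(A_i)|$ is the sum over the semistable factors $A_i$ of $E$. Let $\mathrm{Stab}^\dagger_K(\mathcal{D})$ be the connected component that contains the (nonempty, connected) set of all $\sigma$ whose heart $\mathcal{P}((0,1])$ is $\mathrm{mod}\,\mathbb{C}K_l\subset\mathcal{D}$. The group $\mathbb{C}$ acts by $\sigma.\lambda=(e^{-i\pi\lambda}Z,\{\mathcal{P}(\phi+\mathrm{Re}\,\lambda)\}_{\phi})$. Then $$\bar{d_B}(\bar\sigma,\bar\tau):=\inf_{\lambda\in\mathbb{C}}d_B(\sigma,\tau.\lambda)$$ is a well-defined metric on $\mathrm{Stab}^\dagger_K(\mathcal{D})/\mathbb{C}$, and the metric space $(\mathrm{Stab}^\dagger_K(\mathcal{D})/\mathbb{C},\bar{d_B})$ is not CAT(0): it is not the case that it is a geodesic space in which, for every geodesic triangle, distances between points of the triangle are at most the distances between the corresponding points of a comparison triangle in the Euclidean plane. -/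

import Mathlib

open CategoryTheory CategoryTheory.Limits CategoryTheory.Pretriangulated
open scoped ENNReal TensorProduct

universe w v u

noncomputable section

/-! ### Stability conditions on a triangulated category -/

namespace Bridgeland

section General

variable (C : Type u) [Category.{v} C] [HasZeroObject C] [HasShift C ℤ] [Preadditive C]
  [∀ n : ℤ, (shiftFunctor C n).Additive] [Pretriangulated C]

/-- The relations `[Y] = [X] + [Z]` for all exact triangles `X ⟶ Y ⟶ Z ⟶ X⟦1⟧`. -/
def k0Relations : AddSubgroup (FreeAbelianGroup C) :=
  AddSubgroup.closure {x | ∃ T : Triangle C, T ∈ distTriang C ∧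
    x = FreeAbelianGroup.of T.obj₂ - FreeAbelianGroup.of T.obj₁ - FreeAbelianGroup.of T.obj₃}

/-- The Grothendieck group of the triangulated category `C`. -/
def K0 : Type u := FreeAbelianGroup C ⧸ k0Relations C

instance : AddCommGroup (K0 C) :=
  inferInstanceAs (AddCommGroup (FreeAbelianGroup C ⧸ k0Relations C))

variable {C}

/-- The class of an object in the Grothendieck group. -/
def K0.cls (X : C) : K0 C :=
  QuotientAddGroup.mk' (k0Relations C) (FreeAbelianGroup.of X)

/-- The smallest class of objects that contains `Q` and the zero objects and is closed under
extensions (hence under isomorphisms). -/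
inductive ExtClosure (Q : ObjectProperty C) : C → Prop
  | zero (X : C) (hX : IsZero X) : ExtClosure Q X
  | of (X : C) (hX : Q X) : ExtClosure Q X
  | ext (T : Triangle C) (hT : T ∈ distTriang C) (h₁ : ExtClosure Q T.obj₁)
      (h₃ : ExtClosure Q T.obj₃) : ExtClosure Q T.obj₂

/-- A Harder--Narasimhan filtration of `E` with respect to a family `P` of full subcategories:
a tower `0 = E₀ ⟶ E₁ ⟶ ⋯ ⟶ E_p = E` of exact triangles with nonzero cones `A_i ∈ P(φ_i)`,
`φ₁ > ⋯ > φ_p`. Here `p = len + 1 ≥ 1`, and the factor with index `i : Fin (len + 1)` is the cone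
of the map from the object with index `i` to the object with index `i + 1`. -/
structure HNFiltration (P : ℝ → ObjectProperty C) (E : C) where
  len : ℕ
  obj : Fin (len + 2) → C
  factor : Fin (len + 1) → C
  phase : Fin (len + 1) → ℝ
  isZero_first : IsZero (obj 0)
  last_iso : Nonempty (obj (Fin.last (len + 1)) ≅ E)
  triangle : ∀ i : Fin (len + 1), ∃ (f : obj i.castSucc ⟶ obj i.succ)
    (g : obj i.succ ⟶ factor i) (h : factor i ⟶ (obj i.castSucc)⟦(1 : ℤ)⟧),
    Triangle.mk f g h ∈ distTriang C
  phase_strictAnti : StrictAnti phase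
  mem : ∀ i, P (phase i) (factor i)
  not_isZero : ∀ i, ¬ IsZero (factor i)

/-- A stability condition `(Z, P)` on `C` with respect to `(K(C), id)`. The support property
is expressed by the norm `N` on `K(C) ⊗ ℝ`. The subcategories `P φ` are full additive
subcategories, closed under isomorphisms. -/
@[ext]
structure StabilityCondition (N : Seminorm ℝ (ℝ ⊗[ℤ] K0 C)) where
  /-- the central charge -/
  Z : K0 C →+ ℂ
  /-- the slicing -/
  P : ℝ → ObjectProperty C
  P_iso : ∀ (φ : ℝ) (X Y : C), (X ≅ Y) → P φ X → P φ Y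
  P_zero : ∀ (φ : ℝ) (X : C), IsZero X → P φ X
  P_biprod : ∀ (φ : ℝ) (X Y : C), P φ X → P φ Y → P φ (X ⊞ Y)
  charge : ∀ (φ : ℝ) (E : C), P φ E → ¬ IsZero E →
    ∃ m : ℝ, 0 < m ∧ Z (K0.cls E) = m * Complex.exp (Complex.I * Real.pi * φ)
  shift : ∀ (φ : ℝ) (E : C), P (φ + 1) (E⟦(1 : ℤ)⟧) ↔ P φ E
  hom_eq_zero : ∀ (φ₁ φ₂ : ℝ) (E₁ E₂ : C), φ₂ < φ₁ → P φ₁ E₁ → P φ₂ E₂ →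
    ∀ f : E₁ ⟶ E₂, f = 0
  exists_HN : ∀ E : C, ¬ IsZero E → Nonempty (HNFiltration P E)
  support : ∃ c : ℝ, 0 < c ∧ ∀ (φ : ℝ) (E : C), P φ E → ¬ IsZero E →
    N (1 ⊗ₜ[ℤ] K0.cls E) < c * ‖Z (K0.cls E)‖

namespace StabilityCondition

variable {N : Seminorm ℝ (ℝ ⊗[ℤ] K0 C)}

/-- The (up to isomorphism unique) Harder--Narasimhan filtration of a nonzero object. -/
def HN (σ : StabilityCondition N) (E : C) (hE : ¬ IsZero E) : HNFiltration σ.P E :=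
  Classical.choice (σ.exists_HN E hE)

/-- `φ⁺_σ(E)`, the phase of the first semistable factor. -/
def phiPlus (σ : StabilityCondition N) (E : C) (hE : ¬ IsZero E) : ℝ :=
  (σ.HN E hE).phase 0

/-- `φ⁻_σ(E)`, the phase of the last semistable factor. -/
def phiMinus (σ : StabilityCondition N) (E : C) (hE : ¬ IsZero E) : ℝ :=
  (σ.HN E hE).phase (Fin.last _)

/-- The mass `m_σ(E)`, the sum of the `|Z(A_i)|` over the semistable factors `A_i` of `E`. -/
def mass (σ : StabilityCondition N) (E : C) (hE : ¬ IsZero E) : ℝ :=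
  ∑ i, ‖σ.Z (K0.cls ((σ.HN E hE).factor i))‖

lemma mass_pos (σ : StabilityCondition N) (E : C) (hE : ¬ IsZero E) : 0 < σ.mass E hE := by
  refine Finset.sum_pos (fun i _ => ?_) ⟨0, Finset.mem_univ _⟩
  obtain ⟨m, hm, h⟩ := σ.charge _ _ ((σ.HN E hE).mem i) ((σ.HN E hE).not_isZero i)
  rw [h, norm_pos_iff]
  exact mul_ne_zero (by exact_mod_cast hm.ne') (Complex.exp_ne_zero _)

/-- The term of `d_B(σ, τ)` that belongs to the nonzero object `E`. -/
def distTerm (σ τ : StabilityCondition N) (E : C) (hE : ¬ IsZero E) : ℝ :=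
  max (max |σ.phiPlus E hE - τ.phiPlus E hE| |σ.phiMinus E hE - τ.phiMinus E hE|)
    |Real.log (σ.mass E hE / τ.mass E hE)|

lemma distTerm_self (σ : StabilityCondition N) (E : C) (hE : ¬ IsZero E) :
    distTerm σ σ E hE = 0 := by
  simp [distTerm, div_self (σ.mass_pos E hE).ne']

lemma distTerm_comm (σ τ : StabilityCondition N) (E : C) (hE : ¬ IsZero E) :
    distTerm σ τ E hE = distTerm τ σ E hE := by
  unfold distTerm
  rw [Real.log_div (σ.mass_pos E hE).ne' (τ.mass_pos E hE).ne',
    Real.log_div (τ.mass_pos E hE).ne' (σ.mass_pos E hE).ne',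
    abs_sub_comm (σ.phiPlus E hE), abs_sub_comm (σ.phiMinus E hE),
    abs_sub_comm (Real.log (σ.mass E hE))]

lemma distTerm_nonneg (σ τ : StabilityCondition N) (E : C) (hE : ¬ IsZero E) :
    0 ≤ distTerm σ τ E hE :=
  le_max_of_le_right (abs_nonneg _)

lemma distTerm_triangle (σ τ ρ : StabilityCondition N) (E : C) (hE : ¬ IsZero E) :
    distTerm σ ρ E hE ≤ distTerm σ τ E hE + distTerm τ ρ E hE := by
  unfold distTerm
  rw [Real.log_div (σ.mass_pos E hE).ne' (τ.mass_pos E hE).ne',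
    Real.log_div (σ.mass_pos E hE).ne' (ρ.mass_pos E hE).ne',
    Real.log_div (τ.mass_pos E hE).ne' (ρ.mass_pos E hE).ne']
  refine max_le (max_le ?_ ?_) ?_
  · exact (abs_sub_le _ (τ.phiPlus E hE) _).trans
      (add_le_add (le_max_of_le_left (le_max_left _ _)) (le_max_of_le_left (le_max_left _ _)))
  · exact (abs_sub_le _ (τ.phiMinus E hE) _).trans
      (add_le_add (le_max_of_le_left (le_max_right _ _)) (le_max_of_le_left (le_max_right _ _)))
  · exact (abs_sub_le _ (Real.log (τ.mass E hE)) _).trans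
      (add_le_add (le_max_right _ _) (le_max_right _ _))

/-- Bridgeland's generalized metric
`d_B(σ, τ) = sup_{E ≠ 0} {|φ⁺_σ(E) - φ⁺_τ(E)|, |φ⁻_σ(E) - φ⁻_τ(E)|, |log (m_σ(E) / m_τ(E))|}`. -/
def dB (σ τ : StabilityCondition N) : ℝ≥0∞ :=
  ⨆ (E : C) (hE : ¬ IsZero E), ENNReal.ofReal (distTerm σ τ E hE)

/-- The space of stability conditions carries the generalized metric `d_B` and the topology
that it induces. -/
instance : PseudoEMetricSpace (StabilityCondition N) where
  edist := dB
  edist_self σ := by simp [dB, distTerm_self]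
  edist_comm σ τ := by simp only [dB, distTerm_comm σ τ]
  edist_triangle σ τ ρ := by
    refine iSup₂_le fun E hE => ?_
    calc ENNReal.ofReal (distTerm σ ρ E hE)
        ≤ ENNReal.ofReal (distTerm σ τ E hE + distTerm τ ρ E hE) :=
          ENNReal.ofReal_le_ofReal (distTerm_triangle σ τ ρ E hE)
      _ = ENNReal.ofReal (distTerm σ τ E hE) + ENNReal.ofReal (distTerm τ ρ E hE) :=
          ENNReal.ofReal_add (distTerm_nonneg _ _ _ _) (distTerm_nonneg _ _ _ _)
      _ ≤ dB σ τ + dB τ ρ :=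
          add_le_add
            (le_iSup₂ (f := fun E hE => ENNReal.ofReal (distTerm σ τ E hE)) E hE)
            (le_iSup₂ (f := fun E hE => ENNReal.ofReal (distTerm τ ρ E hE)) E hE)

/-- The action of `λ ∈ ℂ`: `σ.λ = (exp(-iπλ) Z, {P(φ + Re λ)}_φ)`. -/
def act (σ : StabilityCondition N) (z : ℂ) : StabilityCondition N where
  Z := (AddMonoidHom.mulLeft (Complex.exp (-(Complex.I * Real.pi * z)))).comp σ.Z
  P φ := σ.P (φ + z.re)
  P_iso φ := σ.P_iso _
  P_zero φ := σ.P_zero _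
  P_biprod φ := σ.P_biprod _
  charge φ E hE h0 := by
    obtain ⟨m, hm, h⟩ := σ.charge _ E hE h0
    refine ⟨m * Real.exp (Real.pi * z.im), mul_pos hm (Real.exp_pos _), ?_⟩
    have key : -(Complex.I * Real.pi * z) + Complex.I * Real.pi * ((φ + z.re : ℝ) : ℂ) =
        ((Real.pi * z.im : ℝ) : ℂ) + Complex.I * Real.pi * φ := by
      nth_rewrite 1 [← Complex.re_add_im z]
      push_cast
      linear_combination (-(Real.pi : ℂ) * z.im) * Complex.I_mul_I
    simp only [AddMonoidHom.comp_apply, AddMonoidHom.coe_mulLeft, h]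
    rw [mul_left_comm, ← Complex.exp_add, key, Complex.exp_add, ← Complex.ofReal_exp,
      Complex.ofReal_mul, mul_assoc (m : ℂ)]
  shift φ E := by
    have := σ.shift (φ + z.re) E
    rwa [add_right_comm] at this
  hom_eq_zero φ₁ φ₂ E₁ E₂ h := σ.hom_eq_zero _ _ E₁ E₂ (by linarith)
  exists_HN E hE := by
    obtain ⟨F⟩ := σ.exists_HN E hE
    exact ⟨{ len := F.len
             obj := F.obj
             factor := F.factor
             phase := fun i => F.phase i - z.re
             isZero_first := F.isZero_first
             last_iso := F.last_iso
             triangle := F.triangle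
             phase_strictAnti := fun i j h => sub_lt_sub_right (F.phase_strictAnti h) _
             mem := fun i => by simpa using F.mem i
             not_isZero := F.not_isZero }⟩
  support := by
    obtain ⟨c, hc, h⟩ := σ.support
    have h0 : 0 < ‖Complex.exp (-(Complex.I * Real.pi * z))‖ :=
      norm_pos_iff.2 (Complex.exp_ne_zero _)
    refine ⟨c / ‖Complex.exp (-(Complex.I * Real.pi * z))‖, div_pos hc h0, fun φ E hE hE0 => ?_⟩
    refine (h _ E hE hE0).trans_eq ?_
    simp only [AddMonoidHom.comp_apply, AddMonoidHom.coe_mulLeft, norm_mul]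
    field_simp

lemma act_zero (σ : StabilityCondition N) : σ.act 0 = σ := by
  ext
  · simp [act]
  · simp [act]

lemma act_act (σ : StabilityCondition N) (z z' : ℂ) : (σ.act z).act z' = σ.act (z + z') := by
  ext
  · simp only [act, AddMonoidHom.comp_apply, AddMonoidHom.coe_mulLeft]
    rw [← mul_assoc, ← Complex.exp_add]
    ring_nf
  · simp only [act, Complex.add_re]
    rw [add_assoc, add_comm z.re]

/-- The equivalence relation on a set `S` of stability conditions: `σ` and `τ` lie in the same
orbit of the action of `ℂ`. -/
def orbitSetoid (S : Set (StabilityCondition N)) : Setoid S where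
  r σ τ := ∃ z : ℂ, τ.1 = σ.1.act z
  iseqv :=
    { refl := fun σ => ⟨0, (act_zero σ.1).symm⟩
      symm := by
        rintro σ τ ⟨z, hz⟩
        exact ⟨-z, by rw [hz, act_act, add_neg_cancel, act_zero]⟩
      trans := by
        rintro σ τ ρ ⟨z, hz⟩ ⟨z', hz'⟩
        exact ⟨z + z', by rw [hz', hz, act_act]⟩ }

/-- The expression `inf_{λ ∈ ℂ} d_B(σ, τ.λ)`. -/
def dBbar (σ τ : StabilityCondition N) : ℝ≥0∞ := ⨅ z : ℂ, dB σ (τ.act z)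

end StabilityCondition

end General

end Bridgeland

/-! ### CAT(0) spaces -/

namespace MetricGeometry

variable {X : Type u} [MetricSpace X]

/-- `γ`, restricted to `[0, 1]`, is a geodesic from `x` to `y`. -/
def IsGeodesic (γ : ℝ → X) (x y : X) : Prop :=
  γ 0 = x ∧ γ 1 = y ∧ ∀ s ∈ Set.Icc (0 : ℝ) 1, ∀ t ∈ Set.Icc (0 : ℝ) 1,
    dist (γ s) (γ t) = dist x y * |s - t|

variable (X) in
/-- A metric space is CAT(0) if it is geodesic and if, for every geodesic triangle with vertices
`x 0, x 1, x 2` and sides `γ i = [x i, x (i + 1)]` and every comparison triangle with vertices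
`x' 0, x' 1, x' 2` in the Euclidean plane, distances between points of the triangle are
at most the distances between the comparison points. The point of the Euclidean segment
`[x' i, x' (i + 1)]` whose distance to `x' i` is `dist (x i) (γ i s)`, that is the comparison
point of `γ i s`, is the one with parameter `s`. -/
def IsCAT0 : Prop :=
  (∀ x y : X, x ≠ y → ∃ γ : ℝ → X, IsGeodesic γ x y) ∧
  ∀ (x : Fin 3 → X) (γ : Fin 3 → ℝ → X), Function.Injective x →
    (∀ i, IsGeodesic (γ i) (x i) (x (i + 1))) →
    ∀ x' : Fin 3 → EuclideanSpace ℝ (Fin 2),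
      (∀ i, dist (x' i) (x' (i + 1)) = dist (x i) (x (i + 1))) →
      ∀ (i j : Fin 3), ∀ s ∈ Set.Icc (0 : ℝ) 1, ∀ t ∈ Set.Icc (0 : ℝ) 1,
        dist (γ i s) (γ j t) ≤
          dist (AffineMap.lineMap (x' i) (x' (i + 1)) s) (AffineMap.lineMap (x' j) (x' (j + 1)) t)

end MetricGeometry

/-! ### The Kronecker quiver -/

/-- The path algebra over `ℂ` of the `l`-Kronecker quiver, with vertices `1`, `2` and arrows
`α_1, …, α_l : 1 → 2`. Its basis consists of the paths `e₁`, `e₂`, `α_1, …, α_l`, and `(a, b, c)`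
stands for `a e₁ + b e₂ + ∑ i, c i α_i`. -/
def KroneckerAlgebra (l : ℕ) : Type := ℂ × ℂ × (Fin l → ℂ)

namespace KroneckerAlgebra

variable (l : ℕ)

instance : AddCommGroup (KroneckerAlgebra l) := inferInstanceAs (AddCommGroup (ℂ × ℂ × (Fin l → ℂ)))

instance : Module ℂ (KroneckerAlgebra l) := inferInstanceAs (Module ℂ (ℂ × ℂ × (Fin l → ℂ)))

instance : Module.Finite ℂ (KroneckerAlgebra l) :=
  inferInstanceAs (Module.Finite ℂ (ℂ × ℂ × (Fin l → ℂ)))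

/-- Concatenation of paths, where `p q` is the path `q` followed by the path `p`: the nonzero
products of basis elements are `e₁ e₁ = e₁`, `e₂ e₂ = e₂` and `α_i e₁ = α_i = e₂ α_i`.
So left modules are representations of the quiver. -/
instance : Mul (KroneckerAlgebra l) :=
  ⟨fun x y => (x.1 * y.1, x.2.1 * y.2.1, fun i => x.2.2 i * y.1 + x.2.1 * y.2.2 i)⟩

/-- The unit `e₁ + e₂`. -/
instance : One (KroneckerAlgebra l) := ⟨((1 : ℂ), (1 : ℂ), fun _ => (0 : ℂ))⟩

variable {l}

@[ext]
lemma ext' {x y : KroneckerAlgebra l} (h₁ : x.1 = y.1) (h₂ : x.2.1 = y.2.1)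
    (h₃ : ∀ i, x.2.2 i = y.2.2 i) : x = y :=
  Prod.ext h₁ (Prod.ext h₂ (funext h₃))

lemma add_fst (x y : KroneckerAlgebra l) : (x + y).1 = x.1 + y.1 := rfl
lemma add_snd (x y : KroneckerAlgebra l) : (x + y).2.1 = x.2.1 + y.2.1 := rfl
lemma add_arr (x y : KroneckerAlgebra l) (i : Fin l) :
    (x + y).2.2 i = x.2.2 i + y.2.2 i := rfl
lemma mul_fst (x y : KroneckerAlgebra l) : (x * y).1 = x.1 * y.1 := rfl
lemma mul_snd (x y : KroneckerAlgebra l) : (x * y).2.1 = x.2.1 * y.2.1 := rfl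
lemma mul_arr (x y : KroneckerAlgebra l) (i : Fin l) :
    (x * y).2.2 i = x.2.2 i * y.1 + x.2.1 * y.2.2 i := rfl
lemma zero_fst : (0 : KroneckerAlgebra l).1 = 0 := rfl
lemma zero_snd : (0 : KroneckerAlgebra l).2.1 = 0 := rfl
lemma zero_arr (i : Fin l) : (0 : KroneckerAlgebra l).2.2 i = 0 := rfl
lemma one_fst : (1 : KroneckerAlgebra l).1 = 1 := rfl
lemma one_snd : (1 : KroneckerAlgebra l).2.1 = 1 := rfl
lemma one_arr (i : Fin l) : (1 : KroneckerAlgebra l).2.2 i = 0 := rfl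
lemma smul_fst (c : ℂ) (x : KroneckerAlgebra l) : (c • x).1 = c * x.1 := rfl
lemma smul_snd (c : ℂ) (x : KroneckerAlgebra l) : (c • x).2.1 = c * x.2.1 := rfl
lemma smul_arr (c : ℂ) (x : KroneckerAlgebra l) (i : Fin l) :
    (c • x).2.2 i = c * x.2.2 i := rfl

variable (l)

instance : Ring (KroneckerAlgebra l) :=
  { (inferInstance : AddCommGroup (KroneckerAlgebra l)),
    (inferInstance : Mul (KroneckerAlgebra l)),
    (inferInstance : One (KroneckerAlgebra l)) with
    left_distrib := fun x y z => by
      ext <;> simp only [add_fst, add_snd, add_arr, mul_fst, mul_snd, mul_arr] <;> ring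
    right_distrib := fun x y z => by
      ext <;> simp only [add_fst, add_snd, add_arr, mul_fst, mul_snd, mul_arr] <;> ring
    zero_mul := fun x => by
      ext <;> simp only [zero_fst, zero_snd, zero_arr, mul_fst, mul_snd, mul_arr] <;> ring
    mul_zero := fun x => by
      ext <;> simp only [zero_fst, zero_snd, zero_arr, mul_fst, mul_snd, mul_arr] <;> ring
    mul_assoc := fun x y z => by
      ext <;> simp only [mul_fst, mul_snd, mul_arr] <;> ring
    one_mul := fun x => by
      ext <;> simp only [one_fst, one_snd, one_arr, mul_fst, mul_snd, mul_arr] <;> ring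
    mul_one := fun x => by
      ext <;> simp only [one_fst, one_snd, one_arr, mul_fst, mul_snd, mul_arr] <;> ring }

instance : Algebra ℂ (KroneckerAlgebra l) :=
  Algebra.ofModule
    (fun c x y => by
      ext <;> simp only [smul_fst, smul_snd, smul_arr, mul_fst, mul_snd, mul_arr] <;> ring)
    (fun c x y => by
      ext <;> simp only [smul_fst, smul_snd, smul_arr, mul_fst, mul_snd, mul_arr] <;> ring)

instance : IsNoetherianRing (KroneckerAlgebra l) := IsNoetherianRing.of_finite ℂ _

end KroneckerAlgebra

/-- The abelian category of finitely generated modules over the path algebra of the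
`l`-Kronecker quiver. -/
abbrev KroneckerMod (l : ℕ) : Type 1 := FGModuleCat.{0} (KroneckerAlgebra l)

namespace Kronecker

open Bridgeland

variable (l : ℕ) [HasDerivedCategory.{w} (KroneckerMod l)]

/-- The bounded derived category of `KroneckerMod l`. -/
abbrev Db : Type 1 := DerivedCategory.Bounded (KroneckerMod l)

/-- The full subcategory of the bounded derived category formed by the modules, placed in
degree zero (up to isomorphism). -/
def stdHeart : ObjectProperty (Db l) := fun X =>
  ∃ M : KroneckerMod l,
    Nonempty (X.obj ≅ (DerivedCategory.singleFunctor (KroneckerMod l) 0).obj M)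

variable {l} (N : Seminorm ℝ (ℝ ⊗[ℤ] K0 (Db l)))

/-- The set of the stability conditions `(Z, KroneckerMod l)`, that is, of those
whose heart `P((0, 1])` is the category of modules. -/
def stabQuiver : Set (StabilityCondition N) :=
  {σ | ∀ X : Db l, ExtClosure (fun E => ∃ φ ∈ Set.Ioc (0 : ℝ) 1, σ.P φ E) X ↔ stdHeart l X}

/-- The connected component that contains the (nonempty, connected) set `stabQuiver N`, described
as the set of all stability conditions in the connected component of a point of that set. -/
def stabDagger : Set (StabilityCondition N) :=
  {τ | ∃ σ ∈ stabQuiver N, τ ∈ connectedComponent σ}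

/-- The quotient of `stabDagger N` by the action of `ℂ`. -/
def StabDaggerModC : Type _ := Quotient (StabilityCondition.orbitSetoid (stabDagger N))

/-- The orbit of a point of `stabDagger N`. -/
def orbit (σ : stabDagger N) : StabDaggerModC N :=
  Quotient.mk (StabilityCondition.orbitSetoid (stabDagger N)) σ

end Kronecker

end

/-!
The function `dBbar` is a pseudometric for formal reasons, since `ℂ` acts on stability conditions
by isometries of `d_B`. The other two properties of a metric use more.

* It separates orbits. If the infimum is zero, then it is attained, because the extremal phase and
  the mass of one nonzero object leave only one candidate for the translation; and `d_B(σ, τ) = 0`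
  forces `σ = τ`, since Harder--Narasimhan filtrations are unique: the semistable objects of phase
  `φ` are those with `φ⁺ = φ⁻ = φ`, and central charges are determined by masses and phases
  (`HNTower.unique`, `eq_of_dB_eq_zero`, `exists_act_of_dBbar_eq_zero`).
* It is finite. Balls of radius `∞` are open and closed, so points of one connected component are
  at finite distance. It remains to compare two points `σ`, `τ` whose heart is the category of
  modules. For such points the phase of a semistable object is known up to an error of `1` from
  the degree of its homology, and masses are comparable to the total dimension of the homology
  (`homology_tower`, `exists_mass_bounds`, `dB_ne_top_of_mem_stabDagger`).

That the metric is not CAT(0) is seen on the stability conditions whose only stable objects are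
the shifts of the two simple modules `S₁` and `S₂`. Modulo `ℂ` they are determined by the difference
`x ∈ (0, 1)` of the phases of the simple modules and the logarithm `y ∈ ℝ` of the ratio of their
masses. An object has the same Harder--Narasimhan filtration with respect to all of them, and each
factor is an iterated extension of one shifted simple module. This gives
`d_B ≤ max (|x - x'| / 2) (|y - y'| / 2)` for suitable representatives, and evaluation at `S₁` and
`S₂` shows that no other representatives are closer (`dBbar_stripPoint`). So half of the supremum
metric on the strip `(0, 1) × ℝ` embeds isometrically. In the supremum metric, two points with the
same `x` are joined by more than one geodesic: besides the segment there is the curve `tent` with a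
detour in the direction of `x`. Two geodesics with common end points form a triangle with a
degenerate comparison triangle, and the CAT(0) inequality would force them to coincide
(`MetricGeometry.not_isCAT0_of_geodesics`).
-/

open scoped ZeroObject

/-! ### Harder--Narasimhan towers and their uniqueness -/

namespace Bridgeland

section Towers

variable {C : Type u} [Category.{v} C] [HasZeroObject C] [HasShift C ℤ] [Preadditive C]
  [∀ n : ℤ, (shiftFunctor C n).Additive] [Pretriangulated C]

lemma distinguished_of_iso {X Y Z X' Y' Z' : C} {f : X ⟶ Y} {g : Y ⟶ Z} {h : Z ⟶ X⟦(1 : ℤ)⟧}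
    (hT : Triangle.mk f g h ∈ distTriang C) {f' : X' ⟶ Y'} {g' : Y' ⟶ Z'} {h' : Z' ⟶ X'⟦(1 : ℤ)⟧}
    (a : X' ≅ X) (b : Y' ≅ Y) (c : Z' ≅ Z) (h₁ : f' ≫ b.hom = a.hom ≫ f)
    (h₂ : g' ≫ c.hom = b.hom ≫ g) (h₃ : h' ≫ a.hom⟦(1 : ℤ)⟧' = c.hom ≫ h) :
    Triangle.mk f' g' h' ∈ distTriang C :=
  isomorphic_distinguished _ hT _ (Triangle.isoMk _ _ a b c h₁ h₂ h₃)

section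

variable {X Y Z : C} {f : X ⟶ Y} {g : Y ⟶ Z} {h : Z ⟶ X⟦(1 : ℤ)⟧}
  (hT : Triangle.mk f g h ∈ distTriang C)
include hT

lemma exists_desc₂ {B : C} (k : Y ⟶ B) (hk : f ≫ k = 0) : ∃ m : Z ⟶ B, k = g ≫ m :=
  Triangle.yoneda_exact₂ _ hT k hk

lemma exists_desc₃ {B : C} (k : Z ⟶ B) (hk : g ≫ k = 0) : ∃ m : X⟦(1 : ℤ)⟧ ⟶ B, k = h ≫ m :=
  Triangle.yoneda_exact₃ _ hT k hk

lemma exists_lift₂ {B : C} (k : B ⟶ Y) (hk : k ≫ g = 0) : ∃ m : B ⟶ X, k = m ≫ f :=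
  Triangle.coyoneda_exact₂ _ hT k hk

lemma exists_lift₁ {B : C} (k : B ⟶ X⟦(1 : ℤ)⟧) (hk : k ≫ f⟦(1 : ℤ)⟧' = 0) :
    ∃ m : B ⟶ Z, k = m ≫ h :=
  Triangle.coyoneda_exact₁ _ hT k hk

end

lemma K0.cls_triangle (T : Triangle C) (hT : T ∈ distTriang C) :
    K0.cls T.obj₂ = K0.cls T.obj₁ + K0.cls T.obj₃ := by
  have h : QuotientAddGroup.mk' (k0Relations C) (FreeAbelianGroup.of T.obj₂ -
      FreeAbelianGroup.of T.obj₁ - FreeAbelianGroup.of T.obj₃) = 0 :=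
    (QuotientAddGroup.eq_zero_iff _).2 (AddSubgroup.subset_closure ⟨T, hT, rfl⟩)
  rw [map_sub, map_sub, sub_sub, sub_eq_zero] at h
  exact h

lemma K0.cls_mk {X Y Z : C} {f : X ⟶ Y} {g : Y ⟶ Z} {h : Z ⟶ X⟦(1 : ℤ)⟧}
    (hT : Triangle.mk f g h ∈ distTriang C) : K0.cls Y = K0.cls X + K0.cls Z :=
  K0.cls_triangle _ hT

lemma K0.cls_eq_zero (X : C) (hX : IsZero X) : K0.cls X = 0 := by
  have h : Triangle.mk (𝟙 X) (0 : X ⟶ X) 0 ∈ distTriang C :=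
    distinguished_of_iso (contractible_distinguished X) (Iso.refl _) (Iso.refl _)
      (hX.iso (isZero_zero C)) rfl (hX.eq_of_src _ _) (hX.eq_of_src _ _)
  simpa using K0.cls_mk h

lemma K0.cls_iso {X Y : C} (e : X ≅ Y) : K0.cls X = K0.cls Y := by
  have h : Triangle.mk e.hom (0 : Y ⟶ (0 : C)) 0 ∈ distTriang C :=
    distinguished_of_iso (contractible_distinguished X) (Iso.refl _) e.symm (Iso.refl _)
      (by simp) (by simp) (by simp)
  simpa [K0.cls_eq_zero _ (isZero_zero C)] using (K0.cls_mk h).symm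

lemma K0.hom_ext {G : Type*} [AddCommGroup G] {f g : K0 C →+ G}
    (h : ∀ X : C, f (K0.cls X) = g (K0.cls X)) : f = g := by
  refine QuotientAddGroup.addMonoidHom_ext _ (FreeAbelianGroup.lift_ext _ _ fun X => ?_)
  exact h X

/-- A Harder--Narasimhan tower of `E`: the same data as a Harder--Narasimhan filtration, built up
recursively, with the pairs (phase, factor) recorded in a list that begins with the last factor.
The empty list belongs to the zero objects. -/
inductive HNTower (P : ℝ → ObjectProperty C) : List (ℝ × C) → C → Prop
  | nil {E : C} (hE : IsZero E) : HNTower P [] E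
  | cons {L : List (ℝ × C)} {φ : ℝ} {X E A : C} (f : X ⟶ E) (g : E ⟶ A) (h : A ⟶ X⟦(1 : ℤ)⟧)
      (hT : Triangle.mk f g h ∈ distTriang C) (hX : HNTower P L X) (hA : P φ A)
      (hA0 : ¬ IsZero A) (hL : ∀ p ∈ L, φ < p.1) : HNTower P ((φ, A) :: L) E

namespace HNTower

variable {P : ℝ → ObjectProperty C}

lemma of_iso {L : List (ℝ × C)} {E E' : C} (h : HNTower P L E) (e : E ≅ E') :
    HNTower P L E' := by
  cases h with
  | nil hE => exact .nil (hE.of_iso e.symm)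
  | cons f g h hT hX hA hA0 hL =>
    exact .cons (f ≫ e.hom) (e.inv ≫ g) h (distinguished_of_iso hT (Iso.refl _) e.symm (Iso.refl _)
      (by simp) (by simp) (by simp)) hX hA hA0 hL

lemma mem {L : List (ℝ × C)} {E : C} (h : HNTower P L E) :
    ∀ p ∈ L, P p.1 p.2 ∧ ¬ IsZero p.2 := by
  induction h with
  | nil => simp
  | cons f g h hT hX hA hA0 hL ih =>
    intro p hp
    rcases List.mem_cons.1 hp with rfl | hp
    · exact ⟨hA, hA0⟩
    · exact ih p hp

lemma cls {L : List (ℝ × C)} {E : C} (h : HNTower P L E) :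
    K0.cls E = (L.map fun p => K0.cls p.2).sum := by
  induction h with
  | nil hE => simpa using K0.cls_eq_zero _ hE
  | cons f g h hT hX hA hA0 hL ih =>
    simpa [ih, add_comm] using K0.cls_mk hT

lemma of_semistable {φ : ℝ} {E : C} (hE : P φ E) (h0 : ¬ IsZero E) : HNTower P [(φ, E)] E := by
  refine .cons (0 : (0 : C) ⟶ E) (𝟙 E) 0 ?_ (.nil (isZero_zero C)) hE h0 (by simp)
  exact contractible_distinguished₁ E

lemma extClosure {Q : ObjectProperty C} {L : List (ℝ × C)} {E : C} (h : HNTower P L E)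
    (hQ : ∀ p ∈ L, Q p.2) : ExtClosure Q E := by
  induction h with
  | nil hE => exact .zero _ hE
  | cons f g h hT hX hA hA0 hL ih =>
    exact .ext _ hT (ih fun p hp => hQ p (List.mem_cons_of_mem _ hp))
      (.of _ (hQ _ (List.mem_cons_self ..)))

lemma pairwise {L : List (ℝ × C)} {E : C} (h : HNTower P L E) :
    L.Pairwise (fun p q => p.1 < q.1) := by
  induction h with
  | nil => exact .nil
  | cons f g h hT hX hA hA0 hL ih => exact List.pairwise_cons.2 ⟨hL, ih⟩

lemma mono {P' : ℝ → ObjectProperty C} {L : List (ℝ × C)} {E : C} (h : HNTower P L E)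
    (r : ℝ → ℝ) (hr : StrictMono r) (hP : ∀ φ A, P φ A → P' (r φ) A) :
    HNTower P' (L.map fun p => (r p.1, p.2)) E := by
  induction h with
  | nil hE => exact .nil hE
  | cons f g h hT hX hA hA0 hL ih =>
    refine .cons f g h hT ih (hP _ _ hA) hA0 ?_
    simp only [List.mem_map]
    rintro _ ⟨p, hp, rfl⟩
    exact hr (hL p hp)

end HNTower

/-- The list of the pairs (phase, factor) of a Harder--Narasimhan filtration, the last factor
first. -/
def HNFiltration.list {P : ℝ → ObjectProperty C} {E : C} (F : HNFiltration P E) : List (ℝ × C) :=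
  (List.ofFn fun i => (F.phase i, F.factor i)).reverse

lemma HNFiltration.tower {P : ℝ → ObjectProperty C} {E : C} (F : HNFiltration P E) :
    HNTower P F.list E := by
  obtain ⟨e⟩ := F.last_iso
  have key : ∀ (k : ℕ) (hk : k < F.len + 2), HNTower P
      (((List.ofFn fun i => (F.phase i, F.factor i)).take k).reverse) (F.obj ⟨k, hk⟩) := by
    intro k
    induction k with
    | zero => intro _; simpa using HNTower.nil F.isZero_first
    | succ k ih =>
      intro hk
      have hk' : k < F.len + 1 := by omega
      obtain ⟨f, g, h, hT⟩ := F.triangle ⟨k, hk'⟩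
      rw [List.take_succ_eq_append_getElem (by simpa using hk'), List.reverse_append]
      simp only [List.getElem_ofFn, List.reverse_singleton, List.singleton_append]
      refine HNTower.cons f g h hT (ih (by omega)) (F.mem _) (F.not_isZero _) ?_
      intro p hp
      rw [List.mem_reverse, List.mem_take_iff_getElem] at hp
      obtain ⟨i, hi, rfl⟩ := hp
      simp only [List.getElem_ofFn]
      refine F.phase_strictAnti ?_
      simp only [Fin.mk_lt_mk]
      omega
  have := key (F.len + 1) (by omega)
  rw [List.take_of_length_le (by simp)] at this
  exact this.of_iso e

/-- Appending one more factor to a Harder--Narasimhan filtration. -/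
lemma HNFiltration.exists_snoc {P : ℝ → ObjectProperty C} {X E A : C} (F : HNFiltration P X)
    (f : X ⟶ E) (g : E ⟶ A) (h : A ⟶ X⟦(1 : ℤ)⟧) (hT : Triangle.mk f g h ∈ distTriang C) (φ : ℝ)
    (hφ : φ < F.phase (Fin.last _)) (hA : P φ A) (hA0 : ¬ IsZero A) :
    ∃ G : HNFiltration P E, G.phase (Fin.last _) = φ := by
  obtain ⟨e⟩ := F.last_iso
  refine ⟨
    { len := F.len + 1
      obj := Fin.snoc (α := fun _ => C) F.obj E
      factor := Fin.snoc (α := fun _ => C) F.factor A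
      phase := Fin.snoc (α := fun _ => ℝ) F.phase φ
      isZero_first := ?_
      last_iso := ⟨eqToIso (by simp)⟩
      triangle := ?_
      phase_strictAnti := ?_
      mem := ?_
      not_isZero := ?_ }, by simp⟩
  · have := Fin.snoc_castSucc (α := fun _ => C) E F.obj 0
    rw [Fin.castSucc_zero] at this
    rw [this]; exact F.isZero_first
  · intro i
    induction i using Fin.lastCases with
    | last =>
      rw [Fin.snoc_castSucc (α := fun _ => C), Fin.snoc_last (α := fun _ => C),
        Fin.succ_last, Fin.snoc_last (α := fun _ => C)]
      refine ⟨e.hom ≫ f, g, h ≫ e.inv⟦1⟧', distinguished_of_iso hT e (Iso.refl _) (Iso.refl _)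
        (by simp) (by simp) ?_⟩
      simp [← Functor.map_comp]
    | cast i =>
      rw [Fin.snoc_castSucc (α := fun _ => C), Fin.snoc_castSucc (α := fun _ => C),
        Fin.succ_castSucc, Fin.snoc_castSucc (α := fun _ => C)]
      exact F.triangle i
  · intro i j hij
    induction j using Fin.lastCases with
    | last =>
      induction i using Fin.lastCases with
      | last => exact absurd hij (lt_irrefl _)
      | cast i =>
        rw [Fin.snoc_castSucc (α := fun _ => ℝ), Fin.snoc_last (α := fun _ => ℝ)]
        exact hφ.trans_le (F.phase_strictAnti.antitone (Fin.le_last i))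
    | cast j =>
      induction i using Fin.lastCases with
      | last => exact absurd (hij.trans_le (Fin.le_last _)) (lt_irrefl _)
      | cast i =>
        rw [Fin.snoc_castSucc (α := fun _ => ℝ), Fin.snoc_castSucc (α := fun _ => ℝ)]
        exact F.phase_strictAnti (by simpa using hij)
  · intro i
    induction i using Fin.lastCases with
    | last => simpa using hA
    | cast i => simpa using F.mem i
  · intro i
    induction i using Fin.lastCases with
    | last => simpa using hA0
    | cast i => simpa using F.not_isZero i

lemma HNTower.exists_filtration {P : ℝ → ObjectProperty C} {L : List (ℝ × C)} {E : C}
    (h : HNTower P L E) :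
    (¬ IsZero E → Nonempty (HNFiltration P E)) := by
  suffices H : (L = [] ∧ IsZero E) ∨ ∃ F : HNFiltration P E,
      L.head?.map Prod.fst = some (F.phase (Fin.last _)) by
    intro h0
    rcases H with H | ⟨F, -⟩
    · exact absurd H.2 h0
    · exact ⟨F⟩
  induction h with
  | nil hE => exact Or.inl ⟨rfl, hE⟩
  | @cons L φ X E A f g h hT hX hA hA0 hL ih =>
    right
    rcases ih with ⟨rfl, hX0⟩ | ⟨F, hF⟩
    · refine ⟨
        { len := 0
          obj := ![X, E]
          factor := fun _ => A
          phase := fun _ => φ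
          isZero_first := hX0
          last_iso := ⟨Iso.refl _⟩
          triangle := ?_
          phase_strictAnti := fun i j hij => absurd hij (by simp [Fin.fin_one_eq_zero i, Fin.fin_one_eq_zero j])
          mem := fun _ => hA
          not_isZero := fun _ => hA0 }, rfl⟩
      intro i
      obtain rfl : i = 0 := Fin.fin_one_eq_zero i
      exact ⟨f, g, h, hT⟩
    · obtain ⟨p, hp, hp'⟩ := Option.map_eq_some_iff.1 hF
      obtain ⟨G, hG⟩ := F.exists_snoc f g h hT φ
        (hp' ▸ hL p (List.mem_of_mem_head? hp)) hA hA0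
      exact ⟨G, by simp [hG]⟩

variable {N : Seminorm ℝ (ℝ ⊗[ℤ] K0 C)} (σ : StabilityCondition N)

namespace HNTower

variable {σ}

lemma hom_eq_zero {L : List (ℝ × C)} {E A : C} {ψ : ℝ} (h : HNTower σ.P L E) (hA : σ.P ψ A)
    (hL : ∀ p ∈ L, ψ < p.1) (f : E ⟶ A) : f = 0 := by
  induction h with
  | nil hE => exact hE.eq_of_src _ _
  | cons f' g h hT hX hA' hA0 hL' ih =>
    obtain ⟨k, rfl⟩ := exists_desc₂ hT f
      (ih (fun p hp => hL p (List.mem_cons_of_mem _ hp)) _)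
    rw [σ.hom_eq_zero _ _ _ _ (hL _ (List.mem_cons_self ..)) hA' hA k]
    simp

lemma shift_hom_eq_zero {L : List (ℝ × C)} {E A : C} {ψ : ℝ} (h : HNTower σ.P L E)
    (hA : σ.P ψ A) (hL : ∀ p ∈ L, ψ ≤ p.1) (f : E⟦(1 : ℤ)⟧ ⟶ A) : f = 0 := by
  let e : (A⟦(-1 : ℤ)⟧)⟦(1 : ℤ)⟧ ≅ A := shiftNegShift A (1 : ℤ)
  have hA' : σ.P (ψ - 1) (A⟦(-1 : ℤ)⟧) := by
    rw [← σ.shift, sub_add_cancel]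
    exact σ.P_iso _ _ _ e.symm hA
  obtain ⟨k, hk⟩ := (shiftFunctor C (1 : ℤ)).map_surjective (f ≫ e.inv)
  have : k = 0 := h.hom_eq_zero hA' (fun p hp => by linarith [hL p hp]) k
  rw [this, Functor.map_zero] at hk
  rw [← cancel_mono e.inv, ← hk, zero_comp]

lemma last_ne_zero {L : List (ℝ × C)} {φ : ℝ} {X E A : C} {f : X ⟶ E} {g : E ⟶ A}
    {h : A ⟶ X⟦(1 : ℤ)⟧} (hT : Triangle.mk f g h ∈ distTriang C) (hX : HNTower σ.P L X)
    (hA : σ.P φ A) (hA0 : ¬ IsZero A) (hL : ∀ p ∈ L, φ < p.1) : g ≠ 0 := by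
  rintro rfl
  obtain ⟨k, hk⟩ := exists_desc₃ hT (𝟙 A) (by simp)
  rw [hX.shift_hom_eq_zero hA (fun p hp => (hL p hp).le) k, comp_zero] at hk
  exact hA0 ((IsZero.iff_id_eq_zero _).2 hk)

lemma eq_zero_of_comp {L : List (ℝ × C)} {φ : ℝ} {X E A : C} {f : X ⟶ E} {g : E ⟶ A}
    {h : A ⟶ X⟦(1 : ℤ)⟧} (hT : Triangle.mk f g h ∈ distTriang C) (hX : HNTower σ.P L X)
    (hA : σ.P φ A) (hL : ∀ p ∈ L, φ < p.1) (k : X ⟶ X) (hk : k ≫ f = 0) : k = 0 := by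
  obtain ⟨m, hm⟩ := exists_lift₁ hT (k⟦(1 : ℤ)⟧')
    (by simp [← Functor.map_comp, hk])
  rw [hX.shift_hom_eq_zero hA (fun p hp => (hL p hp).le) m, zero_comp] at hm
  exact (shiftFunctor C (1 : ℤ)).map_injective (hm.trans (Functor.map_zero _ _ _).symm)

/-- Harder--Narasimhan filtrations are unique: the last factor is the largest quotient of
smallest phase, which is determined by the vanishing of morphisms to smaller phases. -/
lemma unique {L L' : List (ℝ × C)} {E E' : C} (hE : HNTower σ.P L E) (hE' : HNTower σ.P L' E')
    (e : E ≅ E') : List.Forall₂ (fun p q => p.1 = q.1 ∧ Nonempty (p.2 ≅ q.2)) L L' := by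
  induction hE generalizing L' E' with
  | nil h0 =>
    cases hE' with
    | nil => exact .nil
    | cons f g h hT hX hA hA0 hL =>
      exact absurd ((h0.of_iso e.symm).eq_of_src _ _) (last_ne_zero hT hX hA hA0 hL)
  | @cons L φ X E A f g h hT hX hA hA0 hL ih =>
    cases hE' with
    | nil h0 => exact absurd ((h0.of_iso e).eq_of_src _ _) (last_ne_zero hT hX hA hA0 hL)
    | @cons L' φ' X' _ A' f' g' h' hT' hX' hA' hA0' hL' =>
      obtain rfl : φ = φ' := by
        rcases lt_trichotomy φ φ' with hlt | h | hlt
        · have h0 : e.inv ≫ g = 0 := by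
            refine (HNTower.cons f' g' h' hT' hX' hA' hA0' hL').hom_eq_zero hA ?_ _
            intro p hp
            rcases List.mem_cons.1 hp with rfl | hp
            · exact hlt
            · exact hlt.trans (hL' p hp)
          exact absurd (by rwa [← cancel_epi e.inv, comp_zero])
            (last_ne_zero hT hX hA hA0 hL)
        · exact h
        · have h0 : e.hom ≫ g' = 0 := by
            refine (HNTower.cons f g h hT hX hA hA0 hL).hom_eq_zero hA' ?_ _
            intro p hp
            rcases List.mem_cons.1 hp with rfl | hp
            · exact hlt
            · exact hlt.trans (hL p hp)
          exact absurd (by rwa [← cancel_epi e.hom, comp_zero])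
            (last_ne_zero hT' hX' hA' hA0' hL')
      obtain ⟨a, ha⟩ := exists_lift₂ hT' (f ≫ e.hom)
        (hX.hom_eq_zero hA' hL _)
      obtain ⟨b, hb⟩ := exists_lift₂ hT (f' ≫ e.inv)
        (hX'.hom_eq_zero hA hL' _)
      -- factorizations through the preceding objects of the towers are unique, hence inverse
      have hab : a ≫ b = 𝟙 X := by
        refine sub_eq_zero.1 (eq_zero_of_comp hT hX hA hL _ ?_)
        rw [Preadditive.sub_comp, Category.assoc, ← hb, ← Category.assoc, ← ha]
        simp
      have hba : b ≫ a = 𝟙 X' := by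
        refine sub_eq_zero.1 (eq_zero_of_comp hT' hX' hA' hL' _ ?_)
        rw [Preadditive.sub_comp, Category.assoc, ← ha, ← Category.assoc, ← hb]
        simp
      refine .cons ⟨rfl, ⟨Triangle.π₃.mapIso (isoTriangleOfIso₁₂ _ _ hT hT' ⟨a, b, hab, hba⟩ e ?_)⟩⟩
        (ih hX' ⟨a, b, hab, hba⟩)
      exact ha

end HNTower

namespace StabilityCondition

variable {σ} {L : List (ℝ × C)} {E : C}

lemma exists_tower (σ : StabilityCondition N) (E : C) : ∃ L, HNTower σ.P L E := by
  by_cases hE : IsZero E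
  · exact ⟨_, .nil hE⟩
  · obtain ⟨F⟩ := σ.exists_HN E hE
    exact ⟨_, F.tower⟩

lemma HN_forall₂ (h : HNTower σ.P L E) (hE : ¬ IsZero E) :
    List.Forall₂ (fun p q => p.1 = q.1 ∧ Nonempty (p.2 ≅ q.2)) (σ.HN E hE).list L :=
  (σ.HN E hE).tower.unique h (Iso.refl _)

lemma phases_eq (h : HNTower σ.P L E) (hE : ¬ IsZero E) :
    (σ.HN E hE).list.map Prod.fst = L.map Prod.fst := by
  have := HN_forall₂ h hE
  rw [← List.forall₂_eq_eq_eq, List.forall₂_map_left_iff, List.forall₂_map_right_iff]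
  exact this.imp fun _ _ h => h.1

lemma head?_phase (h : HNTower σ.P L E) (hE : ¬ IsZero E) :
    (L.map Prod.fst).head? = some (σ.phiMinus E hE) := by
  rw [← phases_eq h hE, HNFiltration.list, List.map_reverse, List.head?_reverse, List.map_ofFn,
    List.getLast?_eq_getLast_of_ne_nil (by simp), List.getLast_ofFn]
  rfl

lemma getLast?_phase (h : HNTower σ.P L E) (hE : ¬ IsZero E) :
    (L.map Prod.fst).getLast? = some (σ.phiPlus E hE) := by
  rw [← phases_eq h hE, HNFiltration.list, List.map_reverse, List.getLast?_reverse, List.map_ofFn,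
    List.head?_eq_some_head (by simp), List.head_ofFn]
  rfl

lemma mass_eq (h : HNTower σ.P L E) (hE : ¬ IsZero E) :
    σ.mass E hE = (L.map fun p => ‖σ.Z (K0.cls p.2)‖).sum := by
  have h1 : (σ.HN E hE).list.map (fun p => ‖σ.Z (K0.cls p.2)‖) =
      L.map fun p => ‖σ.Z (K0.cls p.2)‖ := by
    rw [← List.forall₂_eq_eq_eq, List.forall₂_map_left_iff, List.forall₂_map_right_iff]
    exact (HN_forall₂ h hE).imp fun _ _ h => by rw [K0.cls_iso h.2.some]
  rw [← h1, HNFiltration.list, List.map_reverse, List.sum_reverse, List.map_ofFn, List.sum_ofFn]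
  rfl

end StabilityCondition

end Towers

end Bridgeland

/-! ### The action of `ℂ` and the quotient metric -/

namespace Bridgeland

namespace StabilityCondition

variable {C : Type u} [Category.{v} C] [HasZeroObject C] [HasShift C ℤ] [Preadditive C]
  [∀ n : ℤ, (shiftFunctor C n).Additive] [Pretriangulated C]
  {N : Seminorm ℝ (ℝ ⊗[ℤ] K0 C)} {σ τ : StabilityCondition N} {L L' : List (ℝ × C)} {E : C}

lemma exists_mem_phiPlus (h : HNTower σ.P L E) (hE : ¬ IsZero E) :
    ∃ p ∈ L, p.1 = σ.phiPlus E hE := by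
  have := List.mem_of_getLast? (getLast?_phase h hE)
  simpa using this

lemma exists_mem_phiMinus (h : HNTower σ.P L E) (hE : ¬ IsZero E) :
    ∃ p ∈ L, p.1 = σ.phiMinus E hE := by
  have := List.mem_of_head? (head?_phase h hE)
  simpa using this

lemma le_phiPlus (h : HNTower σ.P L E) (hE : ¬ IsZero E) {p : ℝ × C} (hp : p ∈ L) :
    p.1 ≤ σ.phiPlus E hE := by
  obtain ⟨l, hl⟩ := List.getLast?_eq_some_iff.1 (getLast?_phase h hE)
  have h1 : (L.map Prod.fst).Pairwise (· < ·) := List.pairwise_map.2 h.pairwise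
  have h2 : p.1 ∈ L.map Prod.fst := List.mem_map_of_mem hp
  rw [hl] at h1 h2
  rcases List.mem_append.1 h2 with h2 | h2
  · exact ((List.pairwise_append.1 h1).2.2 _ h2 _ (List.mem_singleton_self _)).le
  · exact (List.mem_singleton.1 h2).le

lemma phiMinus_le (h : HNTower σ.P L E) (hE : ¬ IsZero E) {p : ℝ × C} (hp : p ∈ L) :
    σ.phiMinus E hE ≤ p.1 := by
  obtain ⟨l, hl⟩ := List.head?_eq_some_iff.1 (head?_phase h hE)
  have h1 : (L.map Prod.fst).Pairwise (· < ·) := List.pairwise_map.2 h.pairwise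
  have h2 : p.1 ∈ L.map Prod.fst := List.mem_map_of_mem hp
  rw [hl] at h1 h2
  rcases List.mem_cons.1 h2 with h2 | h2
  · exact h2.ge
  · exact ((List.pairwise_cons.1 h1).1 _ h2).le

/-- A bound for the difference of extremal phases: it suffices to match every phase of either
tower with a close phase of the other one. -/
lemma abs_phi_sub_le {r : ℝ} (h : HNTower σ.P L E) (h' : HNTower τ.P L' E) (hE : ¬ IsZero E)
    (h1 : ∀ p ∈ L, ∃ q ∈ L', |p.1 - q.1| ≤ r) (h2 : ∀ q ∈ L', ∃ p ∈ L, |q.1 - p.1| ≤ r) :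
    |σ.phiPlus E hE - τ.phiPlus E hE| ≤ r ∧ |σ.phiMinus E hE - τ.phiMinus E hE| ≤ r := by
  obtain ⟨p, hp, hp'⟩ := exists_mem_phiPlus h hE
  obtain ⟨q, hq, hq'⟩ := exists_mem_phiPlus h' hE
  obtain ⟨a, ha, ha'⟩ := exists_mem_phiMinus h hE
  obtain ⟨b, hb, hb'⟩ := exists_mem_phiMinus h' hE
  obtain ⟨p₁, hp₁, hpp⟩ := h1 p hp
  obtain ⟨q₁, hq₁, hqq⟩ := h2 q hq
  obtain ⟨a₁, ha₁, haa⟩ := h1 a ha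
  obtain ⟨b₁, hb₁, hbb⟩ := h2 b hb
  have i1 := le_phiPlus h' hE hp₁
  have i2 := le_phiPlus h hE hq₁
  have i3 := phiMinus_le h' hE ha₁
  have i4 := phiMinus_le h hE hb₁
  rw [abs_le] at hpp hqq haa hbb
  constructor <;> rw [abs_le] <;> constructor <;> linarith

lemma phi_semistable {φ : ℝ} (hφ : σ.P φ E) (hE : ¬ IsZero E) :
    σ.phiPlus E hE = φ ∧ σ.phiMinus E hE = φ := by
  have h := HNTower.of_semistable hφ hE
  constructor
  · simpa using (getLast?_phase h hE).symm
  · simpa using (head?_phase h hE).symm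

lemma mass_semistable {φ : ℝ} (hφ : σ.P φ E) (hE : ¬ IsZero E) :
    σ.mass E hE = ‖σ.Z (K0.cls E)‖ := by
  simpa using mass_eq (HNTower.of_semistable hφ hE) hE

lemma P_of_phi_eq {φ : ℝ} (hE : ¬ IsZero E) (h1 : σ.phiPlus E hE = φ)
    (h2 : σ.phiMinus E hE = φ) : σ.P φ E := by
  obtain ⟨L, h⟩ := σ.exists_tower E
  have hφ : ∀ p ∈ L, p.1 = φ := fun p hp =>
    le_antisymm (h1 ▸ le_phiPlus h hE hp) (h2 ▸ phiMinus_le h hE hp)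
  cases h with
  | nil h0 => exact absurd h0 hE
  | @cons L ψ X E A f g k hT hX hA hA0 hL =>
    obtain rfl : ψ = φ := hφ _ (List.mem_cons_self ..)
    cases hX with
    | nil hX =>
      have : IsIso g := (Triangle.isZero₁_iff_isIso₂ _ hT).1 hX
      exact σ.P_iso _ _ _ (asIso g).symm hA
    | @cons L' ψ' X' _ A' _ _ _ _ _ _ _ _ =>
      have h3 := hL (ψ', A') (List.mem_cons_self ..)
      have h4 := hφ (ψ', A') (List.mem_cons_of_mem _ (List.mem_cons_self ..))
      exact absurd h4 h3.ne'

lemma charge_eq {φ : ℝ} (hφ : σ.P φ E) (hE : ¬ IsZero E) :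
    σ.Z (K0.cls E) = (‖σ.Z (K0.cls E)‖ : ℝ) * Complex.exp (Complex.I * Real.pi * φ) := by
  obtain ⟨m, hm, h⟩ := σ.charge φ E hφ hE
  have : Complex.I * Real.pi * φ = ((Real.pi * φ : ℝ) : ℂ) * Complex.I := by push_cast; ring
  rw [h, norm_mul, this, Complex.norm_exp_ofReal_mul_I, mul_one, Complex.norm_real,
    Real.norm_of_nonneg hm.le]

lemma distTerm_le_dB (σ τ : StabilityCondition N) (hE : ¬ IsZero E) :
    ENNReal.ofReal (distTerm σ τ E hE) ≤ dB σ τ :=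
  le_iSup₂ (f := fun E hE => ENNReal.ofReal (distTerm σ τ E hE)) E hE

/-- Bridgeland's generalized metric separates stability conditions. -/
lemma eq_of_dB_eq_zero (h : dB σ τ = 0) : σ = τ := by
  have h0 : ∀ (E : C) (hE : ¬ IsZero E), σ.phiPlus E hE = τ.phiPlus E hE ∧
      σ.phiMinus E hE = τ.phiMinus E hE ∧ σ.mass E hE = τ.mass E hE := by
    intro E hE
    have h1 := distTerm_le_dB σ τ hE
    rw [h, nonpos_iff_eq_zero, ENNReal.ofReal_eq_zero, distTerm, max_le_iff, max_le_iff] at h1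
    obtain ⟨⟨h1, h2⟩, h3⟩ := h1
    rw [abs_nonpos_iff] at h1 h2 h3
    refine ⟨sub_eq_zero.1 h1, sub_eq_zero.1 h2, ?_⟩
    rw [Real.log_div (σ.mass_pos E hE).ne' (τ.mass_pos E hE).ne', sub_eq_zero] at h3
    exact Real.log_injOn_pos (σ.mass_pos E hE) (τ.mass_pos E hE) h3
  have hP : ∀ φ E, σ.P φ E ↔ τ.P φ E := by
    intro φ E
    by_cases hE : IsZero E
    · exact ⟨fun _ => τ.P_zero _ _ hE, fun _ => σ.P_zero _ _ hE⟩
    obtain ⟨h1, h2, -⟩ := h0 E hE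
    constructor
    · intro hφ
      obtain ⟨h3, h4⟩ := phi_semistable hφ hE
      exact P_of_phi_eq hE (h1 ▸ h3) (h2 ▸ h4)
    · intro hφ
      obtain ⟨h3, h4⟩ := phi_semistable hφ hE
      exact P_of_phi_eq hE (h1.trans h3) (h2.trans h4)
  refine StabilityCondition.ext (K0.hom_ext fun E => ?_) (funext fun φ => funext fun E =>
    propext (hP φ E))
  obtain ⟨L, hL⟩ := σ.exists_tower E
  rw [hL.cls, map_list_sum, map_list_sum, List.map_map, List.map_map]
  congr 1
  refine List.map_congr_left fun p hp => ?_
  obtain ⟨hp1, hp2⟩ := hL.mem p hp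
  have hm := (h0 p.2 hp2).2.2
  rw [mass_semistable hp1 hp2, mass_semistable ((hP _ _).1 hp1) hp2] at hm
  simp only [Function.comp_apply]
  rw [charge_eq hp1 hp2, charge_eq ((hP _ _).1 hp1) hp2, hm]

lemma tower_act (h : HNTower σ.P L E) (z : ℂ) :
    HNTower (σ.act z).P (L.map fun p => (p.1 - z.re, p.2)) E :=
  h.mono (fun φ => φ - z.re) (fun _ _ h => sub_lt_sub_right h _)
    (fun φ A hA => by simpa [act] using hA)

lemma phi_act (σ : StabilityCondition N) (z : ℂ) (hE : ¬ IsZero E) :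
    (σ.act z).phiPlus E hE = σ.phiPlus E hE - z.re ∧
      (σ.act z).phiMinus E hE = σ.phiMinus E hE - z.re := by
  obtain ⟨L, h⟩ := σ.exists_tower E
  have h' := tower_act h z
  have e : (L.map fun p => (p.1 - z.re, p.2)).map Prod.fst =
      (L.map Prod.fst).map fun φ => φ - z.re := by simp
  have h1 := getLast?_phase h' hE
  have h2 := head?_phase h' hE
  rw [e, List.getLast?_map, getLast?_phase h hE] at h1
  rw [e, List.head?_map, head?_phase h hE] at h2
  simp only [Option.map_some, Option.some.injEq] at h1 h2
  exact ⟨h1.symm, h2.symm⟩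

lemma mass_act (σ : StabilityCondition N) (z : ℂ) (hE : ¬ IsZero E) :
    (σ.act z).mass E hE = Real.exp (Real.pi * z.im) * σ.mass E hE := by
  obtain ⟨L, h⟩ := σ.exists_tower E
  rw [mass_eq (tower_act h z) hE, mass_eq h hE, List.map_map, ← List.sum_map_mul_left]
  congr 1
  refine List.map_congr_left fun p _ => ?_
  simp only [Function.comp_apply, act, AddMonoidHom.comp_apply, AddMonoidHom.coe_mulLeft,
    norm_mul, Complex.norm_exp]
  simp

lemma log_mass_act (σ : StabilityCondition N) (z : ℂ) (hE : ¬ IsZero E) :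
    Real.log ((σ.act z).mass E hE) = Real.pi * z.im + Real.log (σ.mass E hE) := by
  rw [mass_act, Real.log_mul (Real.exp_pos _).ne' (σ.mass_pos E hE).ne', Real.log_exp]

/-- The term of `d_B(σ, τ.z)` that belongs to `E`. -/
lemma distTerm_act (σ τ : StabilityCondition N) (z : ℂ) (hE : ¬ IsZero E) :
    distTerm σ (τ.act z) E hE =
      max (max |σ.phiPlus E hE - τ.phiPlus E hE + z.re| |σ.phiMinus E hE - τ.phiMinus E hE + z.re|)
        |Real.log (σ.mass E hE) - Real.log (τ.mass E hE) - Real.pi * z.im| := by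
  rw [distTerm, Real.log_div (σ.mass_pos E hE).ne' ((τ.act z).mass_pos E hE).ne',
    log_mass_act, (phi_act τ z hE).1, (phi_act τ z hE).2, sub_sub_eq_add_sub, sub_sub_eq_add_sub,
    add_sub_right_comm, add_sub_right_comm, sub_add_eq_sub_sub_swap]

lemma distTerm_act_act (σ τ : StabilityCondition N) (z : ℂ) (hE : ¬ IsZero E) :
    distTerm (σ.act z) (τ.act z) E hE = distTerm σ τ E hE := by
  rw [distTerm_act, distTerm, (phi_act σ z hE).1, (phi_act σ z hE).2, log_mass_act,
    Real.log_div (σ.mass_pos E hE).ne' (τ.mass_pos E hE).ne', sub_right_comm, sub_add_cancel,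
    sub_right_comm, sub_add_cancel]
  congr 2
  ring

lemma dB_act_act (σ τ : StabilityCondition N) (z : ℂ) : dB (σ.act z) (τ.act z) = dB σ τ := by
  simp only [dB, distTerm_act_act]

lemma dB_comm (σ τ : StabilityCondition N) : dB σ τ = dB τ σ := edist_comm σ τ

lemma dB_triangle (σ τ ρ : StabilityCondition N) : dB σ ρ ≤ dB σ τ + dB τ ρ :=
  edist_triangle σ τ ρ

lemma dB_act_le (σ : StabilityCondition N) (z z' : ℂ) :
    dB (σ.act z) (σ.act z') ≤
      ENNReal.ofReal (max |z.re - z'.re| (Real.pi * |z.im - z'.im|)) := by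
  refine iSup₂_le fun E hE => ENNReal.ofReal_le_ofReal ?_
  rw [distTerm_act, (phi_act σ z hE).1, (phi_act σ z hE).2, log_mass_act]
  refine max_le (max_le ?_ ?_) ?_
  · refine le_max_of_le_left (le_of_eq ?_)
    rw [abs_sub_comm]
    congr 1; ring
  · refine le_max_of_le_left (le_of_eq ?_)
    rw [abs_sub_comm]
    congr 1; ring
  · refine le_max_of_le_right (le_of_eq ?_)
    rw [← abs_of_pos Real.pi_pos, ← abs_mul, abs_of_pos Real.pi_pos]
    congr 1; ring

lemma dBbar_act_right (σ τ : StabilityCondition N) (z : ℂ) : dBbar σ (τ.act z) = dBbar σ τ := by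
  refine Equiv.iInf_congr (Equiv.addLeft z) fun w => ?_
  rw [act_act]; rfl

lemma dBbar_comm (σ τ : StabilityCondition N) : dBbar σ τ = dBbar τ σ := by
  refine Equiv.iInf_congr (Equiv.neg ℂ) fun w => ?_
  rw [Equiv.neg_apply, ← dB_act_act _ _ w, act_act, neg_add_cancel, act_zero, dB_comm]

lemma dBbar_act_left (σ τ : StabilityCondition N) (z : ℂ) : dBbar (σ.act z) τ = dBbar σ τ := by
  rw [dBbar_comm, dBbar_act_right, dBbar_comm]

lemma dBbar_le_dB (σ τ : StabilityCondition N) : dBbar σ τ ≤ dB σ τ :=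
  (iInf_le _ 0).trans_eq (by rw [act_zero])

lemma dBbar_triangle (σ τ ρ : StabilityCondition N) : dBbar σ ρ ≤ dBbar σ τ + dBbar τ ρ := by
  simp only [dBbar, ENNReal.iInf_add, ENNReal.add_iInf]
  refine le_iInf fun z => le_iInf fun w => ?_
  refine (iInf_le _ (z + w)).trans ?_
  rw [← dB_act_act τ (ρ.act z) w, act_act]
  exact dB_triangle _ _ _

/-- The infimum that defines `dBbar σ τ` can vanish only if it is attained: the extremal phase
and the mass of one nonzero object single out the only possible translation. -/
lemma exists_act_of_dBbar_eq_zero (h : dBbar σ τ = 0) : ∃ z : ℂ, τ = σ.act z := by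
  by_cases hC : ∀ E : C, IsZero E
  · refine ⟨0, ?_⟩
    rw [act_zero]
    exact eq_of_dB_eq_zero (by simp [dB, hC])
  push Not at hC
  obtain ⟨E, hE⟩ := hC
  -- the translation after which `σ` and `τ` agree on `E` in the phase `φ⁺` and in the mass
  let z₀ : ℂ := ⟨-(σ.phiPlus E hE - τ.phiPlus E hE),
    (Real.log (σ.mass E hE) - Real.log (τ.mass E hE)) / Real.pi⟩
  have key : ∀ z, dB (τ.act z) (τ.act z₀) ≤ dB σ (τ.act z) := by
    intro z
    refine (dB_act_le τ z z₀).trans ((ENNReal.ofReal_le_ofReal ?_).trans (distTerm_le_dB _ _ hE))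
    rw [distTerm_act]
    refine max_le (le_max_of_le_left (le_max_of_le_left (le_of_eq ?_)))
      (le_max_of_le_right (le_of_eq ?_))
    · congr 1
      simp only [z₀]; ring
    · rw [abs_sub_comm, ← abs_of_pos Real.pi_pos, ← abs_mul, abs_of_pos Real.pi_pos]
      congr 1
      simp only [z₀]
      rw [mul_sub, mul_div_cancel₀ _ Real.pi_ne_zero]
  have hz : dB σ (τ.act z₀) = 0 := by
    refine le_antisymm ?_ zero_le
    have h2 : dB σ (τ.act z₀) ≤ dBbar σ τ + dBbar σ τ := by
      rw [← two_mul, dBbar, ENNReal.mul_iInf_of_ne two_ne_zero ENNReal.ofNat_ne_top]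
      refine le_iInf fun z => ?_
      rw [two_mul]
      exact (dB_triangle _ (τ.act z) _).trans (add_le_add le_rfl (key z))
    simpa [h] using h2
  refine ⟨-z₀, ?_⟩
  rw [eq_of_dB_eq_zero hz, act_act, add_neg_cancel, act_zero]

/-- The generalized metric on the quotient of `S` by the action of `ℂ`. -/
noncomputable abbrev orbitEMetricSpace (S : Set (StabilityCondition N)) :
    EMetricSpace (Quotient (orbitSetoid S)) where
  edist := Quotient.lift₂ (fun σ τ => dBbar σ.1 τ.1) (by
    rintro σ τ σ' τ' ⟨z, hz⟩ ⟨w, hw⟩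
    rw [hz, hw, dBbar_act_left, dBbar_act_right])
  edist_self := by
    rintro ⟨σ⟩
    refine le_antisymm ((dBbar_le_dB _ _).trans_eq (edist_self σ.1)) zero_le
  edist_comm := by
    rintro ⟨σ⟩ ⟨τ⟩
    exact dBbar_comm _ _
  edist_triangle := by
    rintro ⟨σ⟩ ⟨τ⟩ ⟨ρ⟩
    exact dBbar_triangle _ _ _
  eq_of_edist_eq_zero := by
    rintro ⟨σ⟩ ⟨τ⟩ h
    exact Quotient.sound (exists_act_of_dBbar_eq_zero h)

/-- Points of one connected component are at finite distance. -/
lemma dB_ne_top_of_mem_connectedComponent (h : τ ∈ connectedComponent σ) : dB τ σ ≠ ⊤ := by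
  have hc : IsClopen (Metric.eball σ ⊤) := ⟨Metric.isClosed_eball_top, Metric.isOpen_eball⟩
  have := hc.connectedComponent_subset (Metric.mem_eball_self ENNReal.zero_lt_top) h
  exact (Metric.mem_eball.1 this).ne

end StabilityCondition

end Bridgeland

/-! ### Geodesics in CAT(0) spaces -/

namespace MetricGeometry

variable {X : Type u} [MetricSpace X]

lemma IsGeodesic.comp_affine {γ : ℝ → X} {x y : X} (h : IsGeodesic γ x y) {a b : ℝ}
    (ha : a ∈ Set.Icc (0 : ℝ) 1) (hb : b ∈ Set.Icc (0 : ℝ) 1) :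
    IsGeodesic (fun s => γ (a + s * (b - a))) (γ a) (γ b) := by
  refine ⟨by simp, by simp, fun s hs t ht => ?_⟩
  have hm : ∀ s ∈ Set.Icc (0 : ℝ) 1, a + s * (b - a) ∈ Set.Icc (0 : ℝ) 1 := by
    intro s hs
    constructor
    · nlinarith [mul_nonneg hs.1 hb.1, mul_nonneg (sub_nonneg.2 hs.2) ha.1]
    · nlinarith [mul_nonneg hs.1 (sub_nonneg.2 hb.2),
        mul_nonneg (sub_nonneg.2 hs.2) (sub_nonneg.2 ha.2)]
  rw [h.2.2 _ (hm s hs) _ (hm t ht), h.2.2 _ ha _ hb, mul_assoc, ← abs_mul, ← abs_neg]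
  congr 2; ring

/-- Geodesics in a CAT(0) space are unique: if two geodesics from `p` to `q` have different
midpoints, then the degenerate triangle whose vertices are `p`, the midpoint of the first geodesic
and `q`, with the second geodesic as its third side, violates the comparison inequality. -/
lemma not_isCAT0_of_geodesics {p q : X} {γ γ' : ℝ → X} (hpq : p ≠ q) (h : IsGeodesic γ p q)
    (h' : IsGeodesic γ' p q) (hne : γ (1 / 2) ≠ γ' (1 / 2)) : ¬ IsCAT0 X := by
  rintro ⟨-, H⟩
  have m0 : (0 : ℝ) ∈ Set.Icc (0 : ℝ) 1 := by simp
  have m1 : (1 : ℝ) ∈ Set.Icc (0 : ℝ) 1 := by simp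
  have mh : (1 / 2 : ℝ) ∈ Set.Icc (0 : ℝ) 1 := by constructor <;> norm_num
  set m := γ (1 / 2) with hm
  set D := dist p q with hD
  have hDpos : 0 < D := dist_pos.2 hpq
  have d1 : dist p m = D / 2 := by
    rw [← h.1, hm, h.2.2 _ m0 _ mh, ← hD]; norm_num; ring
  have d2 : dist m q = D / 2 := by
    rw [← h.2.1, hm, h.2.2 _ mh _ m1, ← hD]; norm_num; ring
  have hpm : p ≠ m := dist_pos.1 (by rw [d1]; positivity)
  have hmq : m ≠ q := dist_pos.1 (by rw [d2]; positivity)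
  -- the comparison triangle lies on a line, and the comparison point of the midpoint of the second
  -- geodesic is the vertex that belongs to `m`
  let u : EuclideanSpace ℝ (Fin 2) := EuclideanSpace.single 0 1
  have hu : ‖u‖ = 1 := by simp [u]
  have key := H ![p, m, q] ![fun s => γ (0 + s * (1 / 2 - 0)), fun s => γ (1 / 2 + s * (1 - 1 / 2)),
    fun s => γ' (1 + s * (0 - 1))] ?_ ?_ ![0, (D / 2) • u, D • u] ?_ 1 2 0 m0 (1 / 2) mh
  · have e : (D / 2) • u = AffineMap.lineMap (D • u) (0 : EuclideanSpace ℝ (Fin 2)) (1 / 2 : ℝ) := by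
      simp only [AffineMap.lineMap_apply, vsub_eq_sub, vadd_eq_add, zero_sub, smul_neg, smul_smul]
      rw [← neg_smul, ← add_smul]
      congr 1; ring
    have hfin : (2 + 1 : Fin 3) = 0 := rfl
    simp only [hfin, Matrix.cons_val_one, Matrix.cons_val_zero, Matrix.cons_val,
      AffineMap.lineMap_apply_zero, ← e, dist_self] at key
    refine hne ?_
    have := dist_le_zero.1 key
    norm_num at this ⊢
    exact this
  · intro i j hij
    have hn : ∀ {a b : X}, a ≠ b → a = b → i = j := fun h h' => absurd h' h
    fin_cases i <;> fin_cases j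
    exacts [rfl, hn hpm hij, hn hpq hij, hn hpm.symm hij, rfl, hn hmq hij, hn hpq.symm hij,
      hn hmq.symm hij, rfl]
  · have e1 := h.comp_affine m0 mh
    have e2 := h.comp_affine mh m1
    have e3 := h'.comp_affine m1 m0
    rw [h.1] at e1
    rw [h.2.1] at e2
    rw [h'.1, h'.2.1] at e3
    intro i
    fin_cases i
    · exact e1
    · exact e2
    · exact e3
  · intro i
    fin_cases i
    · change dist (0 : EuclideanSpace ℝ (Fin 2)) ((D / 2) • u) = dist p m
      rw [d1, dist_zero_left, norm_smul, hu, Real.norm_of_nonneg (by positivity), mul_one]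
    · change dist ((D / 2) • u) (D • u) = dist m q
      rw [d2, dist_eq_norm, ← sub_smul, norm_smul, hu, mul_one, Real.norm_eq_abs, abs_sub_comm,
        abs_of_nonneg (by linarith)]
      ring
    · change dist (D • u) (0 : EuclideanSpace ℝ (Fin 2)) = dist q p
      rw [dist_comm q p, ← hD, dist_zero_right, norm_smul, hu,
        Real.norm_of_nonneg (by positivity), mul_one]

end MetricGeometry

/-! ### Additive functions and the long exact homology sequence -/

/-- A function with natural number values on the objects of an abelian category that is additive
on short exact sequences. -/
structure AdditiveFunction (A : Type u) [Category.{v} A] [Abelian A] where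
  /-- the underlying function -/
  toFun : A → ℕ
  add : ∀ S : ShortComplex A, S.ShortExact → toFun S.X₂ = toFun S.X₁ + toFun S.X₃

namespace AdditiveFunction

variable {A : Type u} [Category.{v} A] [Abelian A] (d : AdditiveFunction A)

lemma eq_zero {X : A} (hX : IsZero X) : d.toFun X = 0 := by
  have h := d.add (ShortComplex.mk (0 : X ⟶ X) (0 : X ⟶ X) (by simp))
    { exact := ShortComplex.exact_of_isZero_X₂ _ hX
      mono_f := ⟨fun _ _ _ => hX.eq_of_tgt _ _⟩
      epi_g := ⟨fun _ _ _ => hX.eq_of_src _ _⟩ }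
  simpa using h

lemma kernel_cokernel {X Y : A} (f : X ⟶ Y) [Mono f] :
    d.toFun Y = d.toFun X + d.toFun (cokernel f) :=
  d.add (ShortComplex.mk f (cokernel.π f) (cokernel.condition f))
    { exact := ShortComplex.exact_cokernel f
      mono_f := (inferInstance : Mono f)
      epi_g := (inferInstance : Epi (cokernel.π f)) }

lemma of_iso {X Y : A} (e : X ≅ Y) : d.toFun X = d.toFun Y := by
  have h := d.kernel_cokernel e.hom
  rw [d.eq_zero (isZero_cokernel_of_epi e.hom), add_zero] at h
  exact h.symm

lemma kernel_add_image {X Y : A} (f : X ⟶ Y) :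
    d.toFun X = d.toFun (kernel f) + d.toFun (image f) :=
  d.add (ShortComplex.mk (kernel.ι f) (factorThruImage f)
      (by rw [← cancel_mono (image.ι f)]; simp))
    { exact := ShortComplex.exact_of_f_is_kernel _
        (isKernelOfComp (image.ι f) f (kernelIsKernel f) _ (image.fac f))
      mono_f := (inferInstance : Mono (kernel.ι f))
      epi_g := (inferInstance : Epi (factorThruImage f)) }

lemma exact {X Y Z : A} (f : X ⟶ Y) (g : Y ⟶ Z) (w : f ≫ g = 0)
    (h : (ShortComplex.mk f g w).Exact) :
    d.toFun Y = d.toFun (image f) + d.toFun (image g) := by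
  rw [d.kernel_add_image g]
  have h' := (ShortComplex.exact_iff_image_eq_kernel _).1 h
  congr 1
  refine d.of_iso ((kernelSubobjectIso g).symm ≪≫ eqToIso ?_ ≪≫ imageSubobjectIso f)
  exact congrArg (fun S : Subobject Y => (S : A)) h'.symm

lemma image_le_right {X Y : A} (f : X ⟶ Y) : d.toFun (image f) ≤ d.toFun Y := by
  rw [d.kernel_cokernel (image.ι f)]; exact Nat.le_add_right _ _

lemma image_le_left {X Y : A} (f : X ⟶ Y) : d.toFun (image f) ≤ d.toFun X := by
  rw [d.kernel_add_image f]; exact Nat.le_add_left _ _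

lemma image_eq_zero {X Y : A} (f : X ⟶ Y) (hf : f = 0) : d.toFun (image f) = 0 := by
  subst hf
  exact d.eq_zero ((isZero_zero A).of_iso imageZero)

variable [HasDerivedCategory.{w} A]

open DerivedCategory

/-- The value of an additive function at the `n`-th homology of an object of the bounded derived
category. -/
noncomputable def homology (n : ℤ) (X : Bounded A) : ℕ :=
  d.toFun ((homologyFunctor A n).obj X.obj)

lemma homology_eq_of_iso {X Y : Bounded A} (e : X ≅ Y) (n : ℤ) :
    d.homology n X = d.homology n Y :=
  d.of_iso ((homologyFunctor A n).mapIso ((Bounded.ι).mapIso e))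

lemma homology_eq_zero_of_isZero {X : Bounded A} (hX : IsZero X) (n : ℤ) :
    d.homology n X = 0 :=
  d.eq_zero ((homologyFunctor A n).map_isZero ((Bounded.ι).map_isZero hX))

lemma homology_shift (X : Bounded A) (n : ℤ) :
    d.homology n (X⟦(1 : ℤ)⟧) = d.homology (n + 1) X :=
  d.of_iso ((homologyFunctor A n).mapIso ((Bounded.ι.commShiftIso (1 : ℤ)).app X) ≪≫
    ((homologyFunctor A 0).shiftIso 1 n (n + 1) (by ring)).app X.obj)

/-- The long exact homology sequence in terms of an additive function: the numbers `r n` are the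
values at the images of the connecting maps `Hⁿ(Z) ⟶ Hⁿ⁺¹(X)`. -/
lemma exists_ranks {X Y Z : Bounded A} {f : X ⟶ Y} {g : Y ⟶ Z} {h : Z ⟶ X⟦(1 : ℤ)⟧}
    (hT : Triangle.mk f g h ∈ distTriang (Bounded A)) :
    ∃ r : ℤ → ℕ, ∀ n, d.homology n Y + r (n - 1) + r n = d.homology n X + d.homology n Z ∧
      r n ≤ d.homology n Z ∧ r n ≤ d.homology (n + 1) X ∧
      (Epi ((homologyFunctor A n).map g.hom) → r n = 0) := by
  have hT' := (Bounded.ι (C := A)).map_distinguished _ hT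
  set T := (Bounded.ι (C := A)).mapTriangle.obj (Triangle.mk f g h)
  refine ⟨fun n => d.toFun (image (HomologySequence.δ T n (n + 1) rfl)), fun n =>
    ⟨?_, d.image_le_left _, d.image_le_right _, fun hn => ?_⟩⟩
  · have h1 := d.exact _ _ _ (HomologySequence.exact₂ T hT' n)
    have h2 := d.exact _ _ _ (HomologySequence.exact₃ T hT' n (n + 1) rfl)
    have h3 := d.exact _ _ _ (HomologySequence.exact₁ T hT' (n - 1) n (by ring))
    have h4 : d.toFun (image (HomologySequence.δ T (n - 1) (n - 1 + 1) rfl)) =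
        d.toFun (image (HomologySequence.δ T (n - 1) n (by ring))) := by
      congr 1
      all_goals grind
    change d.homology n Y = _ at h1
    change d.homology n Z = _ at h2
    change d.homology n X = _ at h3
    dsimp only
    rw [h4, h1, h2, h3]
    ring
  · exact d.image_eq_zero _ ((HomologySequence.epi_homologyMap_mor₂_iff T hT' n (n + 1) rfl).1 hn)

section

variable {X Y Z : Bounded A} {f : X ⟶ Y} {g : Y ⟶ Z} {h : Z ⟶ X⟦(1 : ℤ)⟧}
  (hT : Triangle.mk f g h ∈ distTriang (Bounded A))
include hT

lemma homology_le (n : ℤ) : d.homology n Y ≤ d.homology n X + d.homology n Z := by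
  obtain ⟨r, hr⟩ := d.exists_ranks hT
  have := (hr n).1
  omega

lemma homology_add (H : ∀ n, d.homology n Z = 0 ∨ d.homology (n + 1) X = 0 ∨
      Epi ((homologyFunctor A n).map g.hom)) (n : ℤ) :
    d.homology n Y = d.homology n X + d.homology n Z := by
  obtain ⟨r, hr⟩ := d.exists_ranks hT
  have h0 : ∀ n, r n = 0 := by
    intro n
    obtain ⟨-, h1, h2, h3⟩ := hr n
    rcases H n with H | H | H
    · omega
    · omega
    · exact h3 H
  have := (hr n).1
  rw [h0, h0] at this
  omega

end

lemma homology_biprod_le (X Y : Bounded A) (n : ℤ) :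
    d.homology n (X ⊞ Y) ≤ d.homology n X + d.homology n Y :=
  d.homology_le (binaryBiproductTriangle_distinguished X Y) n

lemma finite_support (X : Bounded A) : (Function.support fun n => d.homology n X).Finite := by
  obtain ⟨⟨a, ha⟩, ⟨b, hb⟩⟩ := X.property
  refine (Set.finite_Icc a b).subset fun n hn => ?_
  by_contra hab
  rw [Set.mem_Icc, not_and_or, not_le, not_le] at hab
  refine hn ?_
  rcases hab with h | h
  · exact d.eq_zero (isZero_of_isGE X.obj a n h)
  · exact d.eq_zero (isZero_of_isLE X.obj b n h)

/-- The total value of an additive function on all the homology objects. -/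
noncomputable def total (X : Bounded A) : ℕ := ∑ᶠ n, d.homology n X

/-- The Euler characteristic that belongs to an additive function. -/
noncomputable def euler (X : Bounded A) : ℤ := ∑ᶠ n : ℤ, n.negOnePow * (d.homology n X : ℤ)

lemma finite_support_euler (X : Bounded A) :
    (Function.support fun n : ℤ => (n.negOnePow : ℤ) * (d.homology n X : ℤ)).Finite :=
  (d.finite_support X).subset fun n hn h0 => hn (by
    dsimp only at h0
    simp [h0])

lemma total_add {X Y Z : Bounded A}
    (h : ∀ n, d.homology n Y = d.homology n X + d.homology n Z) :
    d.total Y = d.total X + d.total Z := by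
  simp only [total, h]
  exact finsum_add_distrib (d.finite_support X) (d.finite_support Z)

lemma euler_add {X Y Z : Bounded A} {f : X ⟶ Y} {g : Y ⟶ Z} {h : Z ⟶ X⟦(1 : ℤ)⟧}
    (hT : Triangle.mk f g h ∈ distTriang (Bounded A)) : d.euler Y = d.euler X + d.euler Z := by
  obtain ⟨r, hr⟩ := d.exists_ranks hT
  have hf : (Function.support fun n : ℤ => (n.negOnePow : ℤ) * (r n : ℤ)).Finite :=
    (d.finite_support Z).subset fun n hn h0 => hn (by
      have := (hr n).2.1
      dsimp only at h0
      have : r n = 0 := by omega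
      simp [this])
  -- the ranks of the connecting maps cancel in the alternating sum
  have hshift : ∑ᶠ n : ℤ, (n.negOnePow : ℤ) * (r (n - 1) : ℤ) =
      - ∑ᶠ n : ℤ, (n.negOnePow : ℤ) * (r n : ℤ) := by
    rw [← finsum_neg_distrib, ← finsum_comp_equiv (Equiv.addRight (1 : ℤ))]
    refine finsum_congr fun n => ?_
    simp [Int.negOnePow_succ]
  have hf' : (Function.support fun n : ℤ => (n.negOnePow : ℤ) * (r (n - 1) : ℤ)).Finite := by
    refine ((hf.preimage (sub_left_injective (b := (1 : ℤ))).injOn)).subset fun n hn h0 => hn ?_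
    dsimp only at h0
    have : (r (n - 1) : ℤ) = 0 := by simpa using h0
    simp [this]
  have e : ∀ n : ℤ, (n.negOnePow : ℤ) * (d.homology n Y : ℤ) + (n.negOnePow : ℤ) * (r (n - 1) : ℤ) +
      (n.negOnePow : ℤ) * (r n : ℤ) =
      (n.negOnePow : ℤ) * (d.homology n X : ℤ) + (n.negOnePow : ℤ) * (d.homology n Z : ℤ) := by
    intro n
    rw [← mul_add, ← mul_add, ← mul_add]
    congr 1
    exact_mod_cast (hr n).1
  have s := finsum_congr e
  rw [finsum_add_distrib ((d.finite_support_euler Y).union hf' |>.subset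
      (Function.support_add _ _)) hf, finsum_add_distrib (d.finite_support_euler Y) hf',
    finsum_add_distrib (d.finite_support_euler X) (d.finite_support_euler Z), hshift] at s
  simp only [euler]
  linarith

lemma total_eq_single {X : Bounded A} {n : ℤ} (h : ∀ m, m ≠ n → d.homology m X = 0) :
    d.total X = d.homology n X :=
  finsum_eq_single _ n h

lemma euler_eq_single {X : Bounded A} {n : ℤ} (h : ∀ m, m ≠ n → d.homology m X = 0) :
    d.euler X = n.negOnePow * d.homology n X :=
  finsum_eq_single _ n fun m hm => by simp [h m hm]

lemma homology_le_total (X : Bounded A) (n : ℤ) : d.homology n X ≤ d.total X :=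
  single_le_finsum n (d.finite_support X) fun _ => Nat.zero_le _

end AdditiveFunction

/-! ### Dimension vectors of modules over the Kronecker algebra -/

namespace KroneckerAlgebra

variable (l : ℕ)

/-- The trivial path at a vertex; the vertices `1`, `2` of the quiver have the indices `0`, `1`. -/
def e (i : Fin 2) : KroneckerAlgebra l :=
  ((![1, 0] i : ℂ), (![0, 1] i : ℂ), fun _ => (0 : ℂ))

/-- The character by which the path algebra acts on the simple module at a vertex. -/
def character (i : Fin 2) : KroneckerAlgebra l →+* ℂ where
  toFun a := ![a.1, a.2.1] i
  map_one' := by fin_cases i <;> rfl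
  map_mul' a b := by fin_cases i <;> rfl
  map_zero' := by fin_cases i <;> rfl
  map_add' a b := by fin_cases i <;> rfl

variable {l}

lemma e_fst (i : Fin 2) : (e l i).1 = ![1, 0] i := rfl
lemma e_snd (i : Fin 2) : (e l i).2.1 = ![0, 1] i := rfl
lemma e_arr (i : Fin 2) (j : Fin l) : (e l i).2.2 j = 0 := rfl
lemma character_zero (a : KroneckerAlgebra l) : character l 0 a = a.1 := rfl
lemma character_one (a : KroneckerAlgebra l) : character l 1 a = a.2.1 := rfl

lemma e_add_e : e l 0 + e l 1 = 1 := by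
  ext <;> simp [e_fst, e_snd, e_arr, add_fst, add_snd, add_arr, one_fst, one_snd, one_arr]

lemma e_mul_e (i j : Fin 2) : e l i * e l j = if i = j then e l i else 0 := by
  fin_cases i <;> fin_cases j <;> ext <;>
    simp [e_fst, e_snd, e_arr, mul_fst, mul_snd, mul_arr, zero_fst, zero_snd, zero_arr]

lemma e_zero_mul (a : KroneckerAlgebra l) : e l 0 * a = character l 0 a • e l 0 := by
  ext <;> simp [e_fst, e_snd, e_arr, character_zero, mul_fst, mul_snd, mul_arr, smul_fst, smul_snd,
    smul_arr]

lemma mul_e_one (a : KroneckerAlgebra l) : a * e l 1 = character l 1 a • e l 1 := by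
  ext <;> simp [e_fst, e_snd, e_arr, character_one, mul_fst, mul_snd, mul_arr, smul_fst, smul_snd,
    smul_arr]

lemma character_e (i j : Fin 2) : character l i (e l j) = if i = j then 1 else 0 := by
  fin_cases i <;> fin_cases j <;> simp [e, character]

lemma character_algebraMap (i : Fin 2) (c : ℂ) :
    character l i (algebraMap ℂ (KroneckerAlgebra l) c) = c := by
  rw [Algebra.algebraMap_eq_smul_one]
  fin_cases i <;> simp [character, smul_fst, smul_snd, one_fst, one_snd]

lemma eq_add {M : Type*} [AddCommGroup M] [Module (KroneckerAlgebra l) M] (m : M) :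
    m = e l 0 • m + e l 1 • m := by
  rw [← add_smul, e_add_e, one_smul]

section Module

variable {M M' M'' : Type*} [AddCommGroup M] [Module (KroneckerAlgebra l) M] [Module ℂ M]
  [IsScalarTower ℂ (KroneckerAlgebra l) M]
  [AddCommGroup M'] [Module (KroneckerAlgebra l) M'] [Module ℂ M']
  [IsScalarTower ℂ (KroneckerAlgebra l) M']
  [AddCommGroup M''] [Module (KroneckerAlgebra l) M''] [Module ℂ M'']
  [IsScalarTower ℂ (KroneckerAlgebra l) M'']

variable (l M) in
/-- The vector space at a vertex of the representation that belongs to a module. -/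
def vertexSpace (i : Fin 2) : Submodule ℂ M where
  carrier := {m | e l i • m = m}
  add_mem' {a b} ha hb := by
    simp only [Set.mem_ofPred_eq] at *
    rw [smul_add, ha, hb]
  zero_mem' := smul_zero _
  smul_mem' c m hm := by
    simp only [Set.mem_ofPred_eq] at *
    rw [smul_comm, hm]

lemma mem_vertexSpace {i : Fin 2} {m : M} : m ∈ vertexSpace l M i ↔ e l i • m = m := Iff.rfl

lemma e_smul_mem (i : Fin 2) (m : M) : e l i • m ∈ vertexSpace l M i := by
  rw [mem_vertexSpace, ← mul_smul, e_mul_e, if_pos rfl]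

lemma map_mem_vertexSpace (f : M →ₗ[KroneckerAlgebra l] M') {i : Fin 2} {m : M}
    (hm : m ∈ vertexSpace l M i) : f m ∈ vertexSpace l M' i := by
  rw [mem_vertexSpace, ← f.map_smul, mem_vertexSpace.1 hm]

/-- The linear map between the vector spaces at a vertex that is induced by a homomorphism. -/
def vertexMap (f : M →ₗ[KroneckerAlgebra l] M') (i : Fin 2) :
    vertexSpace l M i →ₗ[ℂ] vertexSpace l M' i :=
  (f.restrictScalars ℂ).restrict fun _ hm => map_mem_vertexSpace f hm

lemma finrank_vertexSpace_add [Module.Finite ℂ M'] (f : M →ₗ[KroneckerAlgebra l] M')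
    (g : M' →ₗ[KroneckerAlgebra l] M'') (hf : Function.Injective f) (hg : Function.Surjective g)
    (hfg : Function.Exact f g) (i : Fin 2) :
    Module.finrank ℂ (vertexSpace l M' i) =
      Module.finrank ℂ (vertexSpace l M i) + Module.finrank ℂ (vertexSpace l M'' i) := by
  have hf' : Function.Injective (vertexMap f i) := fun a b h =>
    Subtype.ext (hf (congrArg Subtype.val h))
  have hg' : LinearMap.range (vertexMap g i) = ⊤ := by
    rw [LinearMap.range_eq_top]
    rintro ⟨b, hb⟩
    obtain ⟨a, rfl⟩ := hg b
    refine ⟨⟨e l i • a, e_smul_mem i a⟩, Subtype.ext ?_⟩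
    exact (g.map_smul _ _).trans hb
  have hk : LinearMap.ker (vertexMap g i) = LinearMap.range (vertexMap f i) := by
    ext ⟨b, hb⟩
    rw [LinearMap.mem_ker, LinearMap.mem_range]
    constructor
    · intro h
      obtain ⟨a, rfl⟩ := (hfg b).1 (congrArg Subtype.val h)
      refine ⟨⟨e l i • a, e_smul_mem i a⟩, Subtype.ext ?_⟩
      exact (f.map_smul _ _).trans hb
    · rintro ⟨a, ha⟩
      exact Subtype.ext ((hfg b).2 ⟨a, congrArg Subtype.val ha⟩)
  rw [← LinearMap.finrank_range_add_finrank_ker (vertexMap g i), hg', hk, finrank_top,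
    LinearMap.finrank_range_of_inj hf', add_comm]

lemma exists_functional {i : Fin 2} (h : vertexSpace l M i ≠ ⊥) :
    ∃ (g : M →ₗ[ℂ] ℂ) (v : M), v ∈ vertexSpace l M i ∧ g v ≠ 0 := by
  obtain ⟨v, hv, hv0⟩ := (Submodule.ne_bot_iff _).1 h
  by_contra! H
  exact hv0 ((Module.forall_dual_apply_eq_zero_iff ℂ v).1 fun g => H g v hv)

lemma e_smul_smul (i : Fin 2) (hi : i = 0 ∨ vertexSpace l M 0 = ⊥) (a : KroneckerAlgebra l)
    (m : M) : e l i • a • m = character l i a • e l i • m := by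
  rcases eq_or_ne i 0 with rfl | h0
  · rw [← mul_smul, e_zero_mul, smul_assoc]
  obtain rfl : i = 1 := by omega
  have h0 : e l 0 • m = 0 := by
    have h1 := e_smul_mem (l := l) 0 m
    rwa [hi.resolve_left h0, Submodule.mem_bot] at h1
  conv_lhs => rw [eq_add (l := l) m, h0, zero_add, ← mul_smul, ← mul_smul, mul_assoc, mul_e_one,
    mul_smul_comm, e_mul_e, if_pos rfl, smul_assoc]

end Module

/-- The underlying vector space of the simple module at a vertex. -/
def SimpleModule (_l : ℕ) (_i : Fin 2) : Type := ℂ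

namespace SimpleModule

variable (i : Fin 2)

instance : AddCommGroup (SimpleModule l i) := inferInstanceAs (AddCommGroup ℂ)

instance : Module (KroneckerAlgebra l) (SimpleModule l i) := Module.compHom ℂ (character l i)

/-- The identification of the simple module with `ℂ`. -/
def equiv : SimpleModule l i ≃+ ℂ := AddEquiv.refl ℂ

lemma equiv_smul (a : KroneckerAlgebra l) (x : SimpleModule l i) :
    equiv i (a • x) = character l i a * equiv i x := rfl

instance : Module.Finite (KroneckerAlgebra l) (SimpleModule l i) :=
  ⟨⟨{(equiv i).symm 1}, by
    rw [Finset.coe_singleton, eq_top_iff]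
    intro x _
    rw [Submodule.mem_span_singleton]
    refine ⟨algebraMap ℂ _ (equiv i x), (equiv i).injective ?_⟩
    rw [equiv_smul, character_algebraMap, AddEquiv.apply_symm_apply, mul_one]⟩⟩

end SimpleModule

end KroneckerAlgebra

namespace Kronecker

open KroneckerAlgebra
open scoped ModuleCat.Algebra

variable {l : ℕ}

instance (M : KroneckerMod l) : Module.Finite ℂ M.obj :=
  have : Module.Finite (KroneckerAlgebra l) M.obj := M.property
  Module.Finite.trans (KroneckerAlgebra l) M.obj

variable (l) in
/-- The entries of the dimension vector of a module. -/
noncomputable def dim (i : Fin 2) : AdditiveFunction (KroneckerMod l) where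
  toFun M := Module.finrank ℂ (vertexSpace l M.obj i)
  add S hS := by
    have h := hS.map_of_exact (forget₂ (KroneckerMod l) (ModuleCat (KroneckerAlgebra l)))
    exact finrank_vertexSpace_add S.f.hom.hom S.g.hom.hom h.moduleCat_injective_f
      h.moduleCat_surjective_g ((ShortComplex.ShortExact.moduleCat_exact_iff_function_exact _).1 h.exact) i

lemma dim_eq_zero_iff {i : Fin 2} {M : KroneckerMod l} :
    (dim l i).toFun M = 0 ↔ vertexSpace l M.obj i = ⊥ :=
  Submodule.finrank_eq_zero

lemma isZero_of_dim_eq_zero {M : KroneckerMod l} (h : ∀ i, (dim l i).toFun M = 0) :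
    IsZero M := by
  simp only [dim_eq_zero_iff] at h
  rw [IsZero.iff_id_eq_zero]
  refine FGModuleCat.hom_ext (LinearMap.ext fun m => ?_)
  have h1 : ∀ i, e l i • m = 0 := fun i => by
    have := e_smul_mem (l := l) i m
    rwa [h i, Submodule.mem_bot] at this
  change m = 0
  rw [eq_add (l := l) m, h1, h1, add_zero]

variable (l) in
/-- The simple module at a vertex. -/
noncomputable def simple (i : Fin 2) : KroneckerMod l :=
  FGModuleCat.of (KroneckerAlgebra l) (SimpleModule l i)

lemma dim_simple (i j : Fin 2) : (dim l i).toFun (simple l j) = if i = j then 1 else 0 := by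
  split_ifs with h
  · subst h
    have h1 : (SimpleModule.equiv (l := l) i).symm 1 ∈ vertexSpace l (simple l i).obj i := by
      refine (SimpleModule.equiv i).injective ?_
      refine (SimpleModule.equiv_smul _ _ _).trans ?_
      rw [character_e, if_pos rfl, one_mul]
    refine (finrank_eq_one_iff_of_nonzero' (⟨_, h1⟩ : vertexSpace l (simple l i).obj i) ?_).2 ?_
    · intro h0
      have := congrArg (fun x => SimpleModule.equiv (l := l) i x.1) h0
      exact (one_ne_zero : (1 : ℂ) ≠ 0) this
    · rintro ⟨x, hx⟩
      have key : ∀ x : SimpleModule l i, algebraMap ℂ (KroneckerAlgebra l) (SimpleModule.equiv i x) •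
          (SimpleModule.equiv (l := l) i).symm 1 = x := fun x => by
        refine (SimpleModule.equiv i).injective ?_
        rw [SimpleModule.equiv_smul, character_algebraMap, AddEquiv.apply_symm_apply, mul_one]
      exact ⟨SimpleModule.equiv (l := l) i x, Subtype.ext (key x)⟩
  · rw [dim_eq_zero_iff, eq_bot_iff]
    have key : ∀ x : SimpleModule l j, e l i • x = x → x = 0 := fun x hx => by
      have := congrArg (SimpleModule.equiv j) hx
      rw [SimpleModule.equiv_smul, character_e, if_neg (Ne.symm h), zero_mul] at this
      exact (SimpleModule.equiv j).injective (this.symm.trans (map_zero _).symm)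
    exact fun x hx => (Submodule.mem_bot ℂ).2 (key x hx)

/-- A module that does not vanish at the first vertex has the simple module there as a quotient;
a module that vanishes at the first vertex, but not at the second one, has the simple module at
the second vertex as a quotient. -/
lemma exists_epi_simple {M : KroneckerMod l} {i : Fin 2} (hM : (dim l i).toFun M ≠ 0)
    (hi : i = 0 ∨ (dim l 0).toFun M = 0) : ∃ q : M ⟶ simple l i, Epi q := by
  rw [Ne, dim_eq_zero_iff] at hM
  rw [dim_eq_zero_iff] at hi
  obtain ⟨g, v, hv, hgv⟩ := exists_functional hM
  let q : M.obj →ₗ[KroneckerAlgebra l] SimpleModule l i :=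
    { toFun := fun m => (SimpleModule.equiv i).symm (g (e l i • m))
      map_add' := fun a b => by rw [smul_add, map_add, map_add]
      map_smul' := fun a m => by
        refine (SimpleModule.equiv i).injective ?_
        rw [RingHom.id_apply, SimpleModule.equiv_smul, AddEquiv.apply_symm_apply,
          AddEquiv.apply_symm_apply, e_smul_smul i hi, map_smul, smul_eq_mul] }
  have hq : Function.Surjective q := by
    intro x
    refine ⟨(SimpleModule.equiv i x / g v) • v, (SimpleModule.equiv i).injective ?_⟩
    change SimpleModule.equiv i ((SimpleModule.equiv i).symm (g (e l i • _))) = _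
    rw [AddEquiv.apply_symm_apply, smul_comm, mem_vertexSpace.1 hv, map_smul, smul_eq_mul,
      div_mul_cancel₀ _ hgv]
  let q' : M ⟶ simple l i := ObjectProperty.homMk (ModuleCat.ofHom q)
  exact ⟨q', ConcreteCategory.epi_of_surjective q' hq⟩

/-- The largest quotient of a module that is supported at the first vertex. -/
lemma exists_epi_vertex (M : KroneckerMod l) : ∃ (Q : KroneckerMod l) (q : M ⟶ Q), Epi q ∧
    (dim l 0).toFun Q = (dim l 0).toFun M ∧ (dim l 1).toFun Q = 0 := by
  let K : Submodule (KroneckerAlgebra l) M.obj :=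
    { carrier := {m | e l 0 • m = 0}
      add_mem' := fun {a b} ha hb => by
        simp only [Set.mem_ofPred_eq] at *
        rw [smul_add, ha, hb, add_zero]
      zero_mem' := smul_zero _
      smul_mem' := fun a m hm => by
        simp only [Set.mem_ofPred_eq] at *
        rw [e_smul_smul 0 (Or.inl rfl), hm, smul_zero] }
  have hfin : Module.Finite (KroneckerAlgebra l) M.obj := M.property
  have hK : Module.Finite (KroneckerAlgebra l) K := Module.IsNoetherian.finite _ _
  let Q : KroneckerMod l := FGModuleCat.of (KroneckerAlgebra l) (M.obj ⧸ K)
  let q : M ⟶ Q := ObjectProperty.homMk (ModuleCat.ofHom K.mkQ)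
  let K' : KroneckerMod l := FGModuleCat.of (KroneckerAlgebra l) K
  have hadd : (dim l 0).toFun M = (dim l 0).toFun K' + (dim l 0).toFun Q :=
    finrank_vertexSpace_add (M := K'.obj) (M' := M.obj) (M'' := Q.obj) K.subtype K.mkQ
      K.injective_subtype K.mkQ_surjective (LinearMap.exact_subtype_mkQ K) 0
  refine ⟨Q, q, ConcreteCategory.epi_of_surjective q K.mkQ_surjective, ?_, ?_⟩
  · have h0 : (dim l 0).toFun K' = 0 := by
      rw [dim_eq_zero_iff, eq_bot_iff]
      rintro ⟨x, hx⟩ hx'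
      rw [Submodule.mem_bot]
      refine Subtype.ext ?_
      have h1 : e l 0 • x = x := congrArg Subtype.val (mem_vertexSpace.1 hx')
      exact h1.symm.trans hx
    rw [hadd, h0, zero_add]
  · rw [dim_eq_zero_iff, eq_bot_iff]
    intro x hx
    rw [Submodule.mem_bot, ← mem_vertexSpace.1 hx]
    obtain ⟨m, rfl⟩ := K.mkQ_surjective x
    change K.mkQ (e l 1 • m) = 0
    rw [Submodule.mkQ_apply, Submodule.Quotient.mk_eq_zero]
    change e l 0 • e l 1 • m = 0
    rw [← mul_smul, e_mul_e, if_neg (by decide), zero_smul]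

/-- There are no nonzero morphisms between modules supported at different vertices: the image of
such a morphism has dimension vector zero. -/
lemma hom_eq_zero_of_dim {M M' : KroneckerMod l} {i j : Fin 2} (hij : i ≠ j)
    (hM : (dim l i).toFun M = 0) (hM' : (dim l j).toFun M' = 0) (f : M ⟶ M') : f = 0 := by
  have h : IsZero (image f) := isZero_of_dim_eq_zero fun k => by
    obtain rfl | rfl : k = i ∨ k = j := by omega
    · exact Nat.eq_zero_of_le_zero (hM ▸ (dim l _).image_le_left f)
    · exact Nat.eq_zero_of_le_zero (hM' ▸ (dim l _).image_le_right f)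
  rw [← image.fac f, h.eq_of_tgt (factorThruImage f) 0, zero_comp]

end Kronecker

/-! ### The bounded derived category of the Kronecker quiver -/

namespace Kronecker

open Bridgeland DerivedCategory DerivedCategory.TStructure

variable {l : ℕ} [HasDerivedCategory.{w} (KroneckerMod l)]

lemma isZero_homology_iff {X : Db l} {n : ℤ} :
    IsZero ((homologyFunctor (KroneckerMod l) n).obj X.obj) ↔
      ∀ i, (dim l i).homology n X = 0 :=
  ⟨fun h i => (dim l i).eq_zero h, fun h => isZero_of_dim_eq_zero h⟩

lemma isGE_of_homology {X : Db l} {a : ℤ} (h : ∀ i, ∀ n < a, (dim l i).homology n X = 0) :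
    X.obj.IsGE a :=
  (isGE_iff _ _).2 fun n hn => isZero_homology_iff.2 fun i => h i n hn

lemma isLE_of_homology {X : Db l} {a : ℤ} (h : ∀ i n, a < n → (dim l i).homology n X = 0) :
    X.obj.IsLE a :=
  (isLE_iff _ _).2 fun n hn => isZero_homology_iff.2 fun i => h i n hn

lemma isZero_iff_homology {X : Db l} : IsZero X ↔ ∀ i n, (dim l i).homology n X = 0 := by
  refine ⟨fun h i n => (dim l i).homology_eq_zero_of_isZero h n, fun h => ?_⟩
  have h1 : X.obj.IsGE 1 := isGE_of_homology fun i n _ => h i n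
  have h2 : X.obj.IsLE 0 := isLE_of_homology fun i n _ => h i n
  have h3 : IsZero X.obj := t.isZero X.obj 0 1
  rw [IsZero.iff_id_eq_zero]
  exact (Bounded.ι).map_injective (h3.eq_of_src _ _)

/-- A module, placed in degree `n`, as an object of the bounded derived category. -/
noncomputable def single (n : ℤ) (M : KroneckerMod l) : Db l :=
  ⟨(singleFunctor (KroneckerMod l) n).obj M, ⟨n, inferInstance⟩, ⟨n, inferInstance⟩⟩

lemma homology_single (i : Fin 2) (n : ℤ) (M : KroneckerMod l) :
    (dim l i).homology n (single n M) = (dim l i).toFun M :=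
  (dim l i).of_iso ((singleFunctorCompHomologyFunctorIso (KroneckerMod l) n).app M)

lemma homology_single_of_ne (i : Fin 2) {n m : ℤ} (h : m ≠ n) (M : KroneckerMod l) :
    (dim l i).homology m (single n M) = 0 := by
  refine (dim l i).eq_zero ?_
  rcases lt_or_gt_of_ne h with h | h
  · exact isZero_of_isGE ((singleFunctor (KroneckerMod l) n).obj M) n m h
  · exact isZero_of_isLE ((singleFunctor (KroneckerMod l) n).obj M) n m h

lemma exists_iso_single {X : Db l} {n : ℤ}
    (h : ∀ i m, m ≠ n → (dim l i).homology m X = 0) :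
    ∃ M : KroneckerMod l, Nonempty (X ≅ single n M) := by
  have h1 : X.obj.IsGE n := isGE_of_homology fun i m hm => h i m hm.ne
  have h2 : X.obj.IsLE n := isLE_of_homology fun i m hm => h i m hm.ne'
  obtain ⟨M, ⟨e⟩⟩ := exists_iso_singleFunctor_obj_of_isGE_of_isLE X.obj n
  exact ⟨M, ⟨ObjectProperty.isoMk _ e⟩⟩

lemma stdHeart_iff {X : Db l} :
    stdHeart l X ↔ ∀ i n, n ≠ 0 → (dim l i).homology n X = 0 := by
  constructor
  · rintro ⟨M, ⟨e⟩⟩ i n hn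
    have e' : X ≅ single 0 M := ObjectProperty.isoMk _ e
    rw [(dim l i).homology_eq_of_iso e', homology_single_of_ne i hn]
  · intro h
    obtain ⟨M, ⟨e⟩⟩ := exists_iso_single h
    exact ⟨M, ⟨(Bounded.ι).mapIso e⟩⟩

/-- Morphisms from an object in degrees `≤ a` to an object in degrees `> a` vanish. -/
lemma hom_eq_zero_of_lt {X Y : Db l} {a b : ℤ} (hab : a < b)
    (hX : ∀ i n, a < n → (dim l i).homology n X = 0)
    (hY : ∀ i, ∀ n < b, (dim l i).homology n Y = 0) (f : X ⟶ Y) : f = 0 := by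
  have h1 : t.IsLE ((Bounded.ι).obj X) a := isLE_of_homology hX
  have h2 : t.IsGE ((Bounded.ι).obj Y) b := isGE_of_homology hY
  exact (Bounded.ι).map_injective (t.zero ((Bounded.ι).map f) a b hab)

lemma hom_eq_zero_of_vertices {X Y : Db l} {n : ℤ} {i j : Fin 2} (hij : i ≠ j)
    (hX : ∀ k m, m ≠ n → (dim l k).homology m X = 0)
    (hY : ∀ k m, m ≠ n → (dim l k).homology m Y = 0)
    (hX' : (dim l i).homology n X = 0) (hY' : (dim l j).homology n Y = 0) (f : X ⟶ Y) :
    f = 0 := by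
  obtain ⟨M, ⟨e⟩⟩ := exists_iso_single hX
  obtain ⟨M', ⟨e'⟩⟩ := exists_iso_single hY
  rw [(dim l _).homology_eq_of_iso e, homology_single] at hX'
  rw [(dim l _).homology_eq_of_iso e', homology_single] at hY'
  rw [← cancel_epi e.inv, ← cancel_mono e'.hom, comp_zero, zero_comp]
  refine (Bounded.ι).map_injective ?_
  obtain ⟨g, hg⟩ := (singleFunctor (KroneckerMod l) n).map_surjective
    ((Bounded.ι).map ((e.inv ≫ f) ≫ e'.hom))
  rw [← hg, hom_eq_zero_of_dim hij hX' hY' g, Functor.map_zero, Functor.map_zero]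
  rfl

instance epi_homology_single {M Q : KroneckerMod l} (q : M ⟶ Q) [Epi q] (n : ℤ) :
    Epi ((homologyFunctor (KroneckerMod l) n).map ((singleFunctor (KroneckerMod l) n).map q)) := by
  have e := (singleFunctorCompHomologyFunctorIso (KroneckerMod l) n).hom.naturality q
  have e' : (homologyFunctor (KroneckerMod l) n).map ((singleFunctor (KroneckerMod l) n).map q) =
      (singleFunctorCompHomologyFunctorIso (KroneckerMod l) n).hom.app M ≫ q ≫
        (singleFunctorCompHomologyFunctorIso (KroneckerMod l) n).inv.app Q := by
    have e2 := congrArg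
      (fun k => k ≫ (singleFunctorCompHomologyFunctorIso (KroneckerMod l) n).inv.app Q) e
    simpa using e2
  rw [e']
  infer_instance

/-- An object in degrees `≤ n` maps to its top homology. -/
lemma exists_map_single {E : Db l} {n : ℤ} (h : ∀ i m, n < m → (dim l i).homology m E = 0) :
    ∃ (M : KroneckerMod l) (g : E.obj ⟶ (singleFunctor (KroneckerMod l) n).obj M),
      IsIso ((homologyFunctor (KroneckerMod l) n).map g) := by
  have hE : E.obj.IsLE n := isLE_of_homology h
  obtain ⟨X, Y, hX, hY, f, g, k, hT⟩ := t.exists_triangle E.obj (n - 1) n (by ring)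
  have hX' : X.IsLE (n - 1) := ⟨hX⟩
  have hY' : Y.IsGE n := ⟨hY⟩
  have hY'' : Y.IsLE n := (isLE_iff _ _).2 fun m hm =>
    (HomologySequence.exact₃ _ hT m (m + 1) rfl).isZero_of_both_zeros
      ((isZero_of_isLE E.obj n m hm).eq_of_src _ _)
      ((isZero_of_isLE X (n - 1) (m + 1) (by omega)).eq_of_tgt _ _)
  obtain ⟨M, ⟨e⟩⟩ := exists_iso_singleFunctor_obj_of_isGE_of_isLE Y n
  have h1 : Mono ((homologyFunctor (KroneckerMod l) n).map g) :=
    (HomologySequence.mono_homologyMap_mor₂_iff _ hT n).2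
      ((isZero_of_isLE X (n - 1) n (by omega)).eq_of_src _ _)
  have h2 : Epi ((homologyFunctor (KroneckerMod l) n).map g) :=
    (HomologySequence.epi_homologyMap_mor₂_iff _ hT n (n + 1) rfl).2
      ((isZero_of_isLE X (n - 1) (n + 1) (by omega)).eq_of_tgt _ _)
  have h3 : IsIso ((homologyFunctor (KroneckerMod l) n).map g) := isIso_of_mono_of_epi _
  refine ⟨M, g ≫ e.hom, ?_⟩
  rw [Functor.map_comp]
  infer_instance

/-- Splitting off a quotient of the top homology. -/
lemma exists_triangle_of_epi {E : Db l} {n : ℤ}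
    (h : ∀ i m, n < m → (dim l i).homology m E = 0) :
    ∃ M : KroneckerMod l, (∀ i, (dim l i).toFun M = (dim l i).homology n E) ∧
      ∀ (Q : KroneckerMod l) (q : M ⟶ Q), Epi q →
        ∃ (X : Db l) (f : X ⟶ E) (g : E ⟶ single n Q) (k : single n Q ⟶ X⟦(1 : ℤ)⟧),
          Triangle.mk f g k ∈ distTriang (Db l) ∧ ∀ i m,
            (dim l i).homology m E = (dim l i).homology m X + (dim l i).homology m (single n Q) := by
  obtain ⟨M, g, hg⟩ := exists_map_single h
  refine ⟨M, fun i => ?_, fun Q q hq => ?_⟩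
  · rw [← homology_single i n M]
    exact (dim l i).of_iso (asIso ((homologyFunctor (KroneckerMod l) n).map g)).symm
  · let g' : E ⟶ single n Q :=
      ObjectProperty.homMk (g ≫ (singleFunctor (KroneckerMod l) n).map q)
    obtain ⟨X, f, k, hT⟩ := distinguished_cocone_triangle₁ g'
    refine ⟨X, f, g', k, hT, fun i => (dim l i).homology_add hT fun m => ?_⟩
    rcases eq_or_ne m n with rfl | hm
    · right; right
      change Epi ((homologyFunctor (KroneckerMod l) m).map
        (g ≫ (singleFunctor (KroneckerMod l) m).map q))
      rw [Functor.map_comp]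
      infer_instance
    · exact Or.inl (homology_single_of_ne i hm Q)

/-- The total dimension of the homology, the induction parameter for filtrations. -/
noncomputable def size (X : Db l) : ℕ := (dim l 0).total X + (dim l 1).total X

lemma size_add {X Y Z : Db l}
    (h : ∀ i n, (dim l i).homology n Y = (dim l i).homology n X + (dim l i).homology n Z) :
    size Y = size X + size Z := by
  simp only [size, (dim l _).total_add (h _)]
  omega

lemma size_pos {X : Db l} {i : Fin 2} {n : ℤ} (h : (dim l i).homology n X ≠ 0) : 0 < size X := by
  have := (dim l i).homology_le_total X n
  unfold size
  fin_cases i <;> simp at * <;> omega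

/-- The top degree of a nonzero object, together with a vertex that supports the homology in this
degree. The first vertex is preferred: the quotients of a module that are supported at one vertex
are found there first. -/
lemma exists_top {E : Db l} (hE : ¬ IsZero E) : ∃ (i : Fin 2) (n : ℤ),
    (dim l i).homology n E ≠ 0 ∧ (∀ j m, n < m → (dim l j).homology m E = 0) ∧
      (i = 0 ∨ (dim l 0).homology n E = 0) := by
  have hfin : {n : ℤ | ∃ i, (dim l i).homology n E ≠ 0}.Finite := by
    refine (((dim l 0).finite_support E).union ((dim l 1).finite_support E)).subset ?_
    rintro n ⟨i, hi⟩
    fin_cases i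
    · exact Or.inl hi
    · exact Or.inr hi
  have hne : {n : ℤ | ∃ i, (dim l i).homology n E ≠ 0}.Nonempty := by
    rw [isZero_iff_homology] at hE
    push Not at hE
    obtain ⟨i, n, h⟩ := hE
    exact ⟨n, i, h⟩
  obtain ⟨n, ⟨i, hi⟩, hmax⟩ := hfin.exists_maximal hne
  have hm : ∀ j m, n < m → (dim l j).homology m E = 0 := fun j m hm => by
    by_contra h
    exact absurd (hmax ⟨j, h⟩ hm.le) (not_le.2 hm)
  by_cases h0 : (dim l 0).homology n E = 0
  · exact ⟨i, n, hi, hm, Or.inr h0⟩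
  · exact ⟨0, n, h0, hm, Or.inl rfl⟩

lemma cls_shift_single (n : ℤ) (M : KroneckerMod l) :
    K0.cls (single n M) = (n.negOnePow : ℤ) • K0.cls (single 0 M) := by
  have key : ∀ n : ℤ, K0.cls (single n M) = - K0.cls (single (n + 1) M) := by
    intro n
    have e : (single (n + 1) M : Db l)⟦(1 : ℤ)⟧ ≅ single n M :=
      ObjectProperty.isoMk _ (((Bounded.ι).commShiftIso (1 : ℤ)).app (single (n + 1) M) ≪≫
        ((singleFunctors (KroneckerMod l)).shiftIso 1 n (n + 1) (by ring)).app M)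
    have h : K0.cls (0 : Db l) = K0.cls (single (n + 1) M) + K0.cls ((single (n + 1) M)⟦(1 : ℤ)⟧) :=
      K0.cls_mk (contractible_distinguished₂ (single (n + 1) M))
    rw [K0.cls_eq_zero _ (isZero_zero _), K0.cls_iso e] at h
    exact (neg_eq_of_add_eq_zero_right h.symm).symm
  induction n using Int.induction_on with
  | zero => simp
  | succ n ih =>
    have := key n
    rw [ih] at this
    rw [Int.negOnePow_succ, ← neg_eq_iff_eq_neg.2 this]
    simp
  | pred n ih =>
    have := key (-n - 1)
    rw [sub_add_cancel, ih] at this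
    rw [this, Int.negOnePow_sub]
    simp

/-- The Grothendieck group is generated by the classes of the two simple modules. -/
lemma cls_eq (E : Db l) : K0.cls E = (dim l 0).euler E • K0.cls (single 0 (simple l 0)) +
    (dim l 1).euler E • K0.cls (single 0 (simple l 1)) := by
  induction hk : size E using Nat.strong_induction_on generalizing E with
  | _ k ih =>
    by_cases hE : IsZero E
    · rw [K0.cls_eq_zero _ hE]
      simp [AdditiveFunction.euler, (dim l _).homology_eq_zero_of_isZero hE]
    obtain ⟨i, n, hi, htop, hi0⟩ := exists_top hE
    obtain ⟨M, hM, hQ⟩ := exists_triangle_of_epi htop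
    obtain ⟨q, hq⟩ := exists_epi_simple (M := M) (i := i) (by rwa [hM]) (by rwa [hM])
    obtain ⟨X, f, g, k', hT, hadd⟩ := hQ _ q hq
    have hs := size_add hadd
    have hpos : 0 < size (single n (simple l i)) :=
      size_pos (i := i) (n := n) (by rw [homology_single, dim_simple, if_pos rfl]; exact one_ne_zero)
    have he : ∀ j, (dim l j).euler (single n (simple l i)) =
        n.negOnePow * (if j = i then 1 else 0 : ℕ) := fun j => by
      rw [(dim l j).euler_eq_single (fun m hm => homology_single_of_ne j hm _), homology_single,
        dim_simple]
    rw [K0.cls_mk hT, ih (size X) (by omega) X rfl, (dim l 0).euler_add hT, (dim l 1).euler_add hT,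
      cls_shift_single n, he, he, add_smul, add_smul]
    fin_cases i <;> simp <;> abel

end Kronecker

/-! ### Stability conditions whose only stable objects are the shifted simple modules -/

namespace Kronecker

open Bridgeland

variable {l : ℕ} [HasDerivedCategory.{w} (KroneckerMod l)]

/-- The Euler characteristic at a vertex as a homomorphism on the Grothendieck group. -/
noncomputable def eulerHom (i : Fin 2) : K0 (Db l) →+ ℤ :=
  QuotientAddGroup.lift (k0Relations (Db l)) (FreeAbelianGroup.lift fun X => (dim l i).euler X) (by
    rw [k0Relations, AddSubgroup.closure_le]
    rintro _ ⟨T, hT, rfl⟩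
    have h : (dim l i).euler T.obj₂ = (dim l i).euler T.obj₁ + (dim l i).euler T.obj₃ :=
      (dim l i).euler_add (f := T.mor₁) (g := T.mor₂) (h := T.mor₃) hT
    change FreeAbelianGroup.lift (fun X => (dim l i).euler X) _ = 0
    simp [h])

lemma eulerHom_cls (i : Fin 2) (X : Db l) : eulerHom i (K0.cls X) = (dim l i).euler X :=
  FreeAbelianGroup.lift_apply_of _ _

/-- The slicing in which the simple module at the vertex `i` has phase `ph i` and in which the
semistable objects are the shifts of the modules that are supported at a single vertex. -/
def vertexSlice (ph : Fin 2 → ℝ) (φ : ℝ) : ObjectProperty (Db l) :=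
  fun X => ∀ i n, (dim l i).homology n X ≠ 0 → φ = ph i - n

section

variable {ph : Fin 2 → ℝ} (h01 : ph 0 < ph 1) (h10 : ph 1 < ph 0 + 1)
include h01 h10

lemma lt_iff_of_phases (i j : Fin 2) (n m : ℤ) :
    ph i - n < ph j - m ↔ m < n ∨ (m = n ∧ i = 0 ∧ j = 1) := by
  have hij : |ph i - ph j| < 1 := by
    rw [abs_lt]
    fin_cases i <;> fin_cases j <;> constructor <;> simp <;> linarith
  rw [abs_lt] at hij
  constructor
  · intro h
    rcases lt_trichotomy m n with hmn | rfl | hmn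
    · exact Or.inl hmn
    · right
      refine ⟨rfl, ?_⟩
      have h' : ph i < ph j := by linarith
      fin_cases i <;> fin_cases j
      · exact absurd h' (lt_irrefl _)
      · exact ⟨rfl, rfl⟩
      · exact absurd (h'.trans h01) (lt_irrefl _)
      · exact absurd h' (lt_irrefl _)
    · have : (n : ℝ) + 1 ≤ m := by exact_mod_cast hmn
      linarith
  · rintro (hmn | ⟨rfl, rfl, rfl⟩)
    · have : (m : ℝ) + 1 ≤ n := by exact_mod_cast hmn
      linarith
    · linarith

lemma eq_of_phases {i j : Fin 2} {n m : ℤ} (h : ph i - n = ph j - m) : i = j ∧ n = m := by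
  have h1 := (lt_iff_of_phases h01 h10 i j n m).not.1 h.not_lt
  have h2 := (lt_iff_of_phases h01 h10 j i m n).not.1 h.not_gt
  push Not at h1 h2
  obtain rfl : n = m := le_antisymm h1.1 h2.1
  refine ⟨?_, rfl⟩
  have h3 := h1.2 rfl
  have h4 := h2.2 rfl
  omega

lemma vertexSlice_support {φ : ℝ} {X : Db l} (hX : vertexSlice ph φ X) (h0 : ¬ IsZero X) :
    ∃ (i : Fin 2) (n : ℤ), φ = ph i - n ∧ (dim l i).homology n X ≠ 0 ∧
      ∀ j m, j ≠ i ∨ m ≠ n → (dim l j).homology m X = 0 := by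
  rw [isZero_iff_homology] at h0
  push Not at h0
  obtain ⟨i, n, hin⟩ := h0
  refine ⟨i, n, hX i n hin, hin, fun j m hjm => ?_⟩
  by_contra hne
  obtain ⟨h1, h2⟩ := eq_of_phases h01 h10 ((hX j m hne).symm.trans (hX i n hin))
  exact hjm.elim (fun h => h h1) (fun h => h h2)

lemma vertexSlice_hom_eq_zero {φ₁ φ₂ : ℝ} {X Y : Db l} (h : φ₂ < φ₁) (hX : vertexSlice ph φ₁ X)
    (hY : vertexSlice ph φ₂ Y) (f : X ⟶ Y) : f = 0 := by
  by_cases hX0 : IsZero X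
  · exact hX0.eq_of_src _ _
  by_cases hY0 : IsZero Y
  · exact hY0.eq_of_tgt _ _
  obtain ⟨i, n, rfl, -, hX'⟩ := vertexSlice_support h01 h10 hX hX0
  obtain ⟨j, m, rfl, -, hY'⟩ := vertexSlice_support h01 h10 hY hY0
  rcases (lt_iff_of_phases h01 h10 _ _ _ _).1 h with hnm | ⟨rfl, rfl, rfl⟩
  · exact hom_eq_zero_of_lt hnm (fun k m' hm' => hX' k m' (Or.inr hm'.ne'))
      (fun k m' hm' => hY' k m' (Or.inr hm'.ne)) f
  · exact hom_eq_zero_of_vertices (n := n) (i := 0) (j := 1) (by decide)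
      (fun k m' hm' => hX' k m' (Or.inr hm')) (fun k m' hm' => hY' k m' (Or.inr hm'))
      (hX' _ _ (Or.inl (by decide))) (hY' _ _ (Or.inl (by decide))) f

/-- The last Harder--Narasimhan factor is the largest quotient of the top homology that is
supported at the first vertex or, if there is none, the top homology itself. -/
lemma exists_tower_vertexSlice (E : Db l) : ∃ L, HNTower (vertexSlice ph) L E ∧
    ∀ p ∈ L, ∃ i n, (dim l i).homology n E ≠ 0 ∧ p.1 = ph i - n := by
  induction hk : size E using Nat.strong_induction_on generalizing E with
  | _ k ih =>
    by_cases hE : IsZero E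
    · exact ⟨[], .nil hE, by simp⟩
    obtain ⟨i, n, hi, htop, hi0⟩ := exists_top hE
    obtain ⟨M, hM, hQ⟩ := exists_triangle_of_epi htop
    obtain ⟨Q, q, hq, hQi, hQj⟩ : ∃ (Q : KroneckerMod l) (q : M ⟶ Q), Epi q ∧
        (dim l i).toFun Q = (dim l i).toFun M ∧ ∀ j, j ≠ i → (dim l j).toFun Q = 0 := by
      rcases eq_or_ne i 0 with rfl | h0
      · obtain ⟨Q, q, hq, h1, h2⟩ := exists_epi_vertex M
        exact ⟨Q, q, hq, h1, fun j hj => by rwa [show j = 1 by omega]⟩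
      · exact ⟨M, 𝟙 M, inferInstance, rfl, fun j hj => by
          rw [show j = 0 by omega, hM, hi0.resolve_left h0]⟩
    obtain ⟨X, f, g, k', hT, hadd⟩ := hQ Q q hq
    have hA : (dim l i).homology n (single n Q) = (dim l i).homology n E := by
      rw [homology_single, hQi, hM]
    have hs := size_add hadd
    have hpos : 0 < size (single n Q) := size_pos (i := i) (n := n) (by rwa [hA])
    obtain ⟨L, hL, hLp⟩ := ih (size X) (by omega) X rfl
    refine ⟨_, .cons (φ := ph i - n) f g k' hT hL ?_ ?_ ?_, ?_⟩
    · intro j m hjm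
      obtain rfl : m = n := by
        by_contra hm
        exact hjm (homology_single_of_ne j hm Q)
      obtain rfl : j = i := by
        by_contra hj
        exact hjm (by rw [homology_single, hQj j hj])
      rfl
    · intro h0
      exact hi (by rw [← hA, isZero_iff_homology.1 h0])
    · intro p hp
      obtain ⟨j, m, hjm, hp'⟩ := hLp p hp
      rw [hp', lt_iff_of_phases h01 h10]
      have hE' : (dim l j).homology m E ≠ 0 := by
        have := hadd j m
        omega
      have hmn : m ≤ n := by
        by_contra hm
        exact hE' (htop j m (not_le.1 hm))
      rcases hmn.lt_or_eq with hmn | rfl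
      · exact Or.inl hmn
      · refine Or.inr ⟨rfl, ?_⟩
        have hji : j ≠ i := by
          rintro rfl
          have := hadd j m
          omega
        rcases eq_or_ne i 0 with rfl | h0
        · exact ⟨rfl, by omega⟩
        · exact absurd (hi0.resolve_left h0) (by rwa [show (0 : Fin 2) = j by omega])
    · intro p hp
      rcases List.mem_cons.1 hp with rfl | hp
      · exact ⟨i, n, hi, rfl⟩
      · obtain ⟨j, m, hjm, hp'⟩ := hLp p hp
        refine ⟨j, m, ?_, hp'⟩
        have := hadd j m
        omega

end

/-- The central charge that takes the value `z i` at the simple module at the vertex `i`. -/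
noncomputable def charge (z : Fin 2 → ℂ) : K0 (Db l) →+ ℂ :=
  ∑ i, (AddMonoidHom.mulRight (z i)).comp ((Int.castAddHom ℂ).comp (eulerHom i))

lemma charge_cls (z : Fin 2 → ℂ) (X : Db l) :
    charge z (K0.cls X) = ∑ i, ((dim l i).euler X : ℂ) * z i := by
  simp [charge, eulerHom_cls]

lemma sum_euler {M : Type*} [AddCommMonoid M] {X : Db l} {i : Fin 2} {n : ℤ}
    (h : ∀ j m, j ≠ i ∨ m ≠ n → (dim l j).homology m X = 0) (F : ℤ → Fin 2 → M)
    (hF : ∀ j, F 0 j = 0) :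
    ∑ j, F ((dim l j).euler X) j = F (n.negOnePow * (dim l i).homology n X) i := by
  rw [Finset.sum_eq_single i]
  · rw [(dim l i).euler_eq_single fun m hm => h i m (Or.inr hm)]
  · intro j _ hj
    rw [(dim l j).euler_eq_single (n := n) fun m hm => h j m (Or.inr hm), h j n (Or.inl hj)]
    simpa using hF j
  · simp

lemma exp_phase_sub (φ : ℝ) (n : ℤ) :
    Complex.exp (Complex.I * Real.pi * ((φ - n : ℝ) : ℂ)) =
      (n.negOnePow : ℤ) * Complex.exp (Complex.I * Real.pi * φ) := by
  have e : Complex.I * Real.pi * ((φ - n : ℝ) : ℂ) =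
      Complex.I * Real.pi * φ + ((-n : ℤ) : ℂ) * (Real.pi * Complex.I) := by
    push_cast; ring
  rw [e, Complex.exp_add, Complex.exp_int_mul, Complex.exp_pi_mul_I, mul_comm]
  congr 1
  rcases Int.even_or_odd n with hn | hn
  · rw [Int.negOnePow_even n hn, (Even.neg hn).neg_one_zpow]
    simp
  · rw [Int.negOnePow_odd n hn, (Odd.neg hn).neg_one_zpow]
    simp

lemma norm_negOnePow (n : ℤ) : ‖((n.negOnePow : ℤ) : ℂ)‖ = 1 := by
  rcases Int.even_or_odd n with hn | hn
  · simp [Int.negOnePow_even n hn]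
  · simp [Int.negOnePow_odd n hn]

variable (N : Seminorm ℝ (ℝ ⊗[ℤ] K0 (Db l)))

/-- The stability condition in which the simple modules at the two vertices have the phases
`ph 0 < ph 1` and the masses `ms 0`, `ms 1`, and in which they are, up to shift, the only stable
objects. -/
noncomputable def vertexStability (ph ms : Fin 2 → ℝ) (h01 : ph 0 < ph 1) (h10 : ph 1 < ph 0 + 1)
    (hms : ∀ i, 0 < ms i) : StabilityCondition N where
  Z := charge fun i => ms i * Complex.exp (Complex.I * Real.pi * ph i)
  P := vertexSlice ph
  P_iso φ X Y e hX i n h := hX i n (by rwa [(dim l i).homology_eq_of_iso e])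
  P_zero φ X hX i n h := absurd (isZero_iff_homology.1 hX i n) h
  P_biprod φ X Y hX hY i n h := by
    have := (dim l i).homology_biprod_le X Y n
    by_cases h0 : (dim l i).homology n X = 0
    · exact hY i n (by omega)
    · exact hX i n h0
  charge φ E hE h0 := by
    obtain ⟨i, n, rfl, hin, hsupp⟩ := vertexSlice_support h01 h10 hE h0
    refine ⟨(dim l i).homology n E * ms i, by have := hms i; positivity, ?_⟩
    rw [charge_cls, sum_euler hsupp (fun k j => (k : ℂ) *
      (ms j * Complex.exp (Complex.I * Real.pi * ph j))) (by simp), exp_phase_sub]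
    push_cast
    ring
  shift φ E := by
    constructor
    · intro h i n hin
      have := h i (n - 1) (by rwa [(dim l i).homology_shift, sub_add_cancel])
      push_cast at this
      linarith
    · intro h i n hin
      rw [(dim l i).homology_shift] at hin
      have := h i (n + 1) hin
      push_cast at this
      linarith
  hom_eq_zero φ₁ φ₂ X Y h hX hY f := vertexSlice_hom_eq_zero h01 h10 h hX hY f
  exists_HN E hE := by
    obtain ⟨L, hL, -⟩ := exists_tower_vertexSlice h01 h10 E
    exact hL.exists_filtration hE
  support := by
    -- a semistable object has the class of a multiple of one simple module, so that one constant
    -- for each simple module suffices; adding `1` makes the inequality strict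
    refine ⟨∑ i, (N (1 ⊗ₜ[ℤ] K0.cls (single 0 (simple l i))) + 1) / ms i,
      Finset.sum_pos (fun i _ => div_pos (by positivity) (hms i)) Finset.univ_nonempty,
      fun φ E hE h0 => ?_⟩
    obtain ⟨i, n, rfl, hin, hsupp⟩ := vertexSlice_support h01 h10 hE h0
    set d := (dim l i).homology n E with hd
    have hd0 : (0 : ℝ) < d := by positivity
    rw [charge_cls, sum_euler hsupp (fun k j => (k : ℂ) *
      (ms j * Complex.exp (Complex.I * Real.pi * ph j))) (by simp)]
    have hn : ‖((((n.negOnePow : ℤ) * (d : ℤ) : ℤ)) : ℂ) *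
        (ms i * Complex.exp (Complex.I * Real.pi * ph i))‖ = d * ms i := by
      have e : Complex.I * Real.pi * ph i = ((Real.pi * ph i : ℝ) : ℂ) * Complex.I := by
        push_cast; ring
      rw [norm_mul, norm_mul, e, Complex.norm_exp_ofReal_mul_I, mul_one, Complex.norm_real,
        Real.norm_of_nonneg (hms i).le, Int.cast_mul, norm_mul, norm_negOnePow, one_mul]
      simp
    have hN : N (1 ⊗ₜ[ℤ] K0.cls E) = d * N (1 ⊗ₜ[ℤ] K0.cls (single 0 (simple l i))) := by
      have hc : K0.cls E = ∑ j, (dim l j).euler E • K0.cls (single 0 (simple l j)) := by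
        rw [cls_eq E, Fin.sum_univ_two]
      rw [hc, sum_euler hsupp (fun k j => k • K0.cls (single 0 (simple l j))) (by simp),
        TensorProduct.tmul_smul, ← Int.cast_smul_eq_zsmul ℝ, map_smul_eq_mul]
      congr 1
      rcases Int.even_or_odd n with hn | hn
      · simp [Int.negOnePow_even n hn, hd]
      · simp [Int.negOnePow_odd n hn, hd]
    rw [hn, hN]
    have h1 : (N (1 ⊗ₜ[ℤ] K0.cls (single 0 (simple l i))) + 1) / ms i ≤
        ∑ i, (N (1 ⊗ₜ[ℤ] K0.cls (single 0 (simple l i))) + 1) / ms i :=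
      Finset.single_le_sum (f := fun i => (N (1 ⊗ₜ[ℤ] K0.cls (single 0 (simple l i))) + 1) / ms i)
        (fun j _ => div_nonneg (by positivity) (hms j).le) (Finset.mem_univ i)
    calc d * N (1 ⊗ₜ[ℤ] K0.cls (single 0 (simple l i)))
        < d * (N (1 ⊗ₜ[ℤ] K0.cls (single 0 (simple l i))) + 1) := by
          exact mul_lt_mul_of_pos_left (by linarith) hd0
      _ = (N (1 ⊗ₜ[ℤ] K0.cls (single 0 (simple l i))) + 1) / ms i * (d * ms i) := by
          have := (hms i).ne'
          field_simp
      _ ≤ _ := by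
          refine mul_le_mul_of_nonneg_right h1 ?_
          have := hms i
          positivity

lemma vertexStability_mem (ph ms : Fin 2 → ℝ) (h01 : ph 0 < ph 1) (h10 : ph 1 < ph 0 + 1)
    (hms : ∀ i, 0 < ms i) (h0 : 0 < ph 0) (h1 : ph 1 ≤ 1) :
    vertexStability N ph ms h01 h10 hms ∈ stabQuiver N := by
  have hph : ∀ i, 0 < ph i ∧ ph i ≤ 1 := by
    intro i
    fin_cases i <;> constructor <;> simp <;> linarith
  intro X
  rw [stdHeart_iff]
  constructor
  · intro h
    induction h with
    | zero X hX => exact fun i n _ => isZero_iff_homology.1 hX i n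
    | of X hX =>
      obtain ⟨φ, ⟨hφ0, hφ1⟩, hX⟩ := hX
      intro i n hn
      by_contra hne
      have h2 : φ = ph i - n := hX i n hne
      obtain ⟨h3, h4⟩ := hph i
      refine hn (le_antisymm ?_ ?_)
      · have : (n : ℝ) < 1 := by linarith
        have : n < 1 := by exact_mod_cast this
        omega
      · have : (-1 : ℝ) < n := by linarith
        have : -1 < n := by exact_mod_cast this
        omega
    | ext T hT _ _ ih₁ ih₃ =>
      intro i n hn
      have := (dim l i).homology_le (f := T.mor₁) (g := T.mor₂) (h := T.mor₃) hT n
      have h1 := ih₁ i n hn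
      have h3 := ih₃ i n hn
      omega
  · intro h
    obtain ⟨L, hL, hLp⟩ := exists_tower_vertexSlice h01 h10 X
    refine hL.extClosure fun p hp => ⟨p.1, ?_, (hL.mem p hp).1⟩
    obtain ⟨i, n, hin, hp'⟩ := hLp p hp
    obtain rfl : n = 0 := by
      by_contra hn
      exact hin (h i n hn)
    rw [hp']
    simpa using hph i

end Kronecker

/-! ### Stability conditions whose heart is the category of modules -/

namespace Kronecker

open Bridgeland StabilityCondition

variable {l : ℕ} [HasDerivedCategory.{w} (KroneckerMod l)]
  {N : Seminorm ℝ (ℝ ⊗[ℤ] K0 (Db l))} {σ τ : StabilityCondition N}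

/-- The phase of a semistable object determines the only degree in which it has homology. -/
lemma phase_mem_of_homology (hσ : σ ∈ stabQuiver N) {φ : ℝ} {A : Db l} (hA : σ.P φ A) {i : Fin 2}
    {n : ℤ} (h : (dim l i).homology n A ≠ 0) : φ ∈ Set.Ioc (-n : ℝ) (-n + 1) := by
  have key : ∀ (k : ℤ) (φ : ℝ) (A : Db l), σ.P φ A → φ ∈ Set.Ioc (k : ℝ) (k + 1) →
      ∀ i n, n ≠ -k → (dim l i).homology n A = 0 := by
    intro k
    induction k using Int.induction_on with
    | zero =>
      intro φ A hA hφ i n hn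
      exact stdHeart_iff.1 ((hσ A).1 (.of A ⟨φ, by simpa using hφ, hA⟩)) i n (by simpa using hn)
    | succ k ih =>
      intro φ A hA hφ i n hn
      let e : (A⟦(-1 : ℤ)⟧)⟦(1 : ℤ)⟧ ≅ A := shiftNegShift A (1 : ℤ)
      have hA' : σ.P (φ - 1) (A⟦(-1 : ℤ)⟧) := by
        rw [← σ.shift, sub_add_cancel]
        exact σ.P_iso _ _ _ e.symm hA
      rw [← (dim l i).homology_eq_of_iso e, (dim l i).homology_shift]
      refine ih _ _ hA' ?_ i (n + 1) (by omega)
      push_cast at hφ ⊢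
      exact ⟨by linarith [hφ.1], by linarith [hφ.2]⟩
    | pred k ih =>
      intro φ A hA hφ i n hn
      have h1 := ih (φ + 1) _ ((σ.shift φ A).2 hA) ?_ i (n - 1) (by omega)
      · rwa [(dim l i).homology_shift, sub_add_cancel] at h1
      · push_cast at hφ ⊢
        exact ⟨by linarith [hφ.1], by linarith [hφ.2]⟩
  by_contra hφ
  refine h (key (⌈φ⌉ - 1) φ A hA ?_ i n ?_)
  · push_cast
    exact ⟨by linarith [Int.ceil_lt_add_one φ], by linarith [Int.le_ceil φ]⟩
  · rintro rfl
    refine hφ ?_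
    push_cast
    exact ⟨by linarith [Int.ceil_lt_add_one φ], by linarith [Int.le_ceil φ]⟩

/-- The homology of an object is composed of the homologies of its Harder--Narasimhan factors:
the connecting maps vanish for reasons of degree. -/
lemma homology_tower (hσ : σ ∈ stabQuiver N) {L : List (ℝ × Db l)} {E : Db l}
    (h : HNTower σ.P L E) (i : Fin 2) (n : ℤ) :
    (dim l i).homology n E = (L.map fun p => (dim l i).homology n p.2).sum := by
  induction h generalizing n with
  | nil hE => simpa using (dim l i).homology_eq_zero_of_isZero hE n
  | @cons L φ X E A f g k hT hX hA hA0 hL ih =>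
    rw [(dim l i).homology_add hT, ih, List.map_cons, List.sum_cons, add_comm]
    intro m
    by_contra! H
    obtain ⟨h1, h2, -⟩ := H
    rw [ih] at h2
    obtain ⟨x, hx, hx0⟩ : ∃ p ∈ L, (dim l i).homology (m + 1) p.2 ≠ 0 := by
      by_contra! H
      exact h2 (List.sum_eq_zero (List.forall_mem_map.2 H))
    -- homology of the last factor in degree `m` and of an earlier one in degree `m + 1` would
    -- contradict the order of the phases
    have h3 := phase_mem_of_homology hσ hA h1
    have h4 := phase_mem_of_homology hσ (hX.mem x hx).1 hx0
    have h5 := hL x hx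
    push_cast at h4
    linarith [h3.1, h4.2]

lemma total_tower (hσ : σ ∈ stabQuiver N) {L : List (ℝ × Db l)} {E : Db l}
    (h : HNTower σ.P L E) (i : Fin 2) :
    (dim l i).total E = (L.map fun p => (dim l i).total p.2).sum := by
  have h1 := homology_tower hσ h i
  have hfin : ∀ L : List (ℝ × Db l), (Function.support fun n : ℤ =>
      (L.map fun p => (dim l i).homology n p.2).sum).Finite := fun L => by
    induction L with
    | nil => simp
    | cons p L ih =>
      simp only [List.map_cons, List.sum_cons]
      exact (((dim l i).finite_support p.2).union ih).subset (Function.support_add _ _)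
  simp only [AdditiveFunction.total, h1]
  clear h1 h
  induction L with
  | nil => simp
  | cons p L ih =>
    simp only [List.map_cons, List.sum_cons]
    rw [finsum_add_distrib ((dim l i).finite_support _) (hfin L), ih]

/-- Towers of the same object for two stability conditions have factors in the same degrees. -/
lemma exists_mem_of_mem (hσ : σ ∈ stabQuiver N) (hτ : τ ∈ stabQuiver N) {L L' : List (ℝ × Db l)}
    {E : Db l} (h : HNTower σ.P L E) (h' : HNTower τ.P L' E) {p : ℝ × Db l} (hp : p ∈ L) :
    ∃ q ∈ L', ∃ i n, (dim l i).homology n p.2 ≠ 0 ∧ (dim l i).homology n q.2 ≠ 0 := by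
  have h0 := (h.mem p hp).2
  rw [isZero_iff_homology] at h0
  push Not at h0
  obtain ⟨i, n, hin⟩ := h0
  have h1 : (dim l i).homology n E ≠ 0 := by
    rw [homology_tower hσ h]
    have := List.single_le_sum (l := L.map fun p => (dim l i).homology n p.2) (by simp) _
      (List.mem_map_of_mem (f := fun p => (dim l i).homology n p.2) hp)
    omega
  rw [homology_tower hτ h'] at h1
  obtain ⟨q, hq, hq0⟩ : ∃ q ∈ L', (dim l i).homology n q.2 ≠ 0 := by
    by_contra! H
    exact h1 (List.sum_eq_zero (List.forall_mem_map.2 H))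
  exact ⟨q, hq, i, n, hin, hq0⟩

lemma not_isZero_single_simple (i : Fin 2) : ¬ IsZero (single 0 (simple l i)) := fun h => by
  have := isZero_iff_homology.1 h i 0
  rw [homology_single, dim_simple, if_pos rfl] at this
  exact one_ne_zero this

/-- The charges of the two simple modules lie in the upper half plane, together with the negative
real half line. -/
lemma charge_simple (hσ : σ ∈ stabQuiver N) (i : Fin 2) :
    0 < (σ.Z (K0.cls (single 0 (simple l i)))).im ∨
      ((σ.Z (K0.cls (single 0 (simple l i)))).im = 0 ∧
        (σ.Z (K0.cls (single 0 (simple l i)))).re < 0) := by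
  have key : ∀ X : Db l, ExtClosure (fun E => ∃ φ ∈ Set.Ioc (0 : ℝ) 1, σ.P φ E) X →
      IsZero X ∨ 0 < (σ.Z (K0.cls X)).im ∨
        ((σ.Z (K0.cls X)).im = 0 ∧ (σ.Z (K0.cls X)).re < 0) := by
    intro X hX
    induction hX with
    | zero X hX => exact Or.inl hX
    | of X hX =>
      by_cases h0 : IsZero X
      · exact Or.inl h0
      obtain ⟨φ, ⟨hφ0, hφ1⟩, hX⟩ := hX
      obtain ⟨m, hm, h⟩ := σ.charge φ X hX h0
      have e : Complex.I * Real.pi * φ = ((Real.pi * φ : ℝ) : ℂ) * Complex.I := by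
        push_cast; ring
      right
      rw [h, e, Complex.re_ofReal_mul, Complex.im_ofReal_mul, Complex.exp_ofReal_mul_I_re,
        Complex.exp_ofReal_mul_I_im]
      rcases hφ1.lt_or_eq with hlt | rfl
      · exact Or.inl (mul_pos hm (Real.sin_pos_of_pos_of_lt_pi (by positivity)
          (by nlinarith [Real.pi_pos])))
      · right
        simp [hm]
    | ext T hT _ _ h₁ h₃ =>
      rcases h₁ with h₁ | h₁
      · rcases h₃ with h₃ | h₃
        · exact Or.inl (Triangle.isZero₂_of_isZero₁₃ T hT h₁ h₃)
        · rw [K0.cls_triangle T hT, K0.cls_eq_zero _ h₁, zero_add]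
          exact Or.inr h₃
      · rcases h₃ with h₃ | h₃
        · rw [K0.cls_triangle T hT, K0.cls_eq_zero _ h₃, add_zero]
          exact Or.inr h₁
        · right
          rw [K0.cls_triangle T hT, map_add, Complex.add_im, Complex.add_re]
          rcases h₁ with h₁ | ⟨h₁, h₁'⟩ <;> rcases h₃ with h₃ | ⟨h₃, h₃'⟩
          · exact Or.inl (by linarith)
          · exact Or.inl (by linarith)
          · exact Or.inl (by linarith)
          · exact Or.inr ⟨by linarith, by linarith⟩
  refine (key _ ((hσ _).2 (stdHeart_iff.2 fun j n hn => ?_))).resolve_left (not_isZero_single_simple i)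
  exact homology_single_of_ne j hn _

/-- Nonnegative combinations of two vectors of the half plane are bounded below, because some
linear functional is positive on both vectors. -/
lemma exists_lower_bound {z : Fin 2 → ℂ} (hz : ∀ i, 0 < (z i).im ∨ ((z i).im = 0 ∧ (z i).re < 0)) :
    ∃ c : ℝ, 0 < c ∧ ∀ a b : ℝ, 0 ≤ a → 0 ≤ b → c * (a + b) ≤ ‖a * z 0 + b * z 1‖ := by
  have h1 : ∀ i, ∃ ε : ℝ, 0 < ε ∧ ∀ δ, 0 < δ → δ ≤ ε → 0 < (z i).im - δ * (z i).re := by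
    intro i
    rcases hz i with h | ⟨h, h'⟩
    · refine ⟨(z i).im / (|(z i).re| + 1), by positivity, fun δ hδ hδε => ?_⟩
      rw [le_div_iff₀ (by positivity)] at hδε
      nlinarith [le_abs_self (z i).re]
    · refine ⟨1, one_pos, fun δ hδ _ => ?_⟩
      rw [h]
      nlinarith
  obtain ⟨ε₀, h0, h0'⟩ := h1 0
  obtain ⟨ε₁, h1, h1'⟩ := h1 1
  set δ := min ε₀ ε₁
  have hδ : 0 < δ := lt_min h0 h1
  have e0 := h0' δ hδ (min_le_left _ _)
  have e1 := h1' δ hδ (min_le_right _ _)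
  set m := min ((z 0).im - δ * (z 0).re) ((z 1).im - δ * (z 1).re)
  have hm : 0 < m := lt_min e0 e1
  refine ⟨m / (1 + δ), by positivity, fun a b ha hb => ?_⟩
  rw [div_mul_eq_mul_div, div_le_iff₀ (by positivity)]
  set u : ℂ := a * z 0 + b * z 1 with hu
  have hre : u.re = a * (z 0).re + b * (z 1).re := by simp [hu]
  have him : u.im = a * (z 0).im + b * (z 1).im := by simp [hu]
  have h2 : m * (a + b) ≤ u.im - δ * u.re := by
    rw [hre, him]
    nlinarith [mul_le_mul_of_nonneg_left (min_le_left ((z 0).im - δ * (z 0).re)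
      ((z 1).im - δ * (z 1).re)) ha, mul_le_mul_of_nonneg_left
      (min_le_right ((z 0).im - δ * (z 0).re) ((z 1).im - δ * (z 1).re)) hb]
  have h3 := Complex.abs_im_le_norm u
  have h4 := Complex.abs_re_le_norm u
  have h5 := le_abs_self u.im
  have h6 := neg_abs_le u.re
  nlinarith

/-- The absolute value of the charge of a semistable object in terms of its total dimensions. -/
lemma norm_charge_semistable (hσ : σ ∈ stabQuiver N) {φ : ℝ} {A : Db l} (hA : σ.P φ A)
    (h0 : ¬ IsZero A) :
    ‖σ.Z (K0.cls A)‖ = ‖(((dim l 0).total A : ℝ) : ℂ) * σ.Z (K0.cls (single 0 (simple l 0))) +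
      (((dim l 1).total A : ℝ) : ℂ) * σ.Z (K0.cls (single 0 (simple l 1)))‖ := by
  rw [isZero_iff_homology] at h0
  push Not at h0
  obtain ⟨i, n, hin⟩ := h0
  have h1 := phase_mem_of_homology hσ hA hin
  have h2 : ∀ j m, m ≠ n → (dim l j).homology m A = 0 := by
    intro j m hm
    by_contra hne
    have h3 := phase_mem_of_homology hσ hA hne
    refine hm (le_antisymm ?_ ?_)
    · have : (m : ℝ) < n + 1 := by linarith [h1.1, h3.2]
      exact Int.lt_add_one_iff.1 (by exact_mod_cast this)
    · have : (n : ℝ) < m + 1 := by linarith [h3.1, h1.2]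
      exact Int.lt_add_one_iff.1 (by exact_mod_cast this)
  rw [cls_eq, (dim l 0).euler_eq_single (h2 0), (dim l 1).euler_eq_single (h2 1),
    (dim l 0).total_eq_single (h2 0), (dim l 1).total_eq_single (h2 1), map_add, map_zsmul,
    map_zsmul, mul_smul, mul_smul, ← smul_add, zsmul_eq_mul, norm_mul, norm_negOnePow, one_mul]
  simp

/-- The mass is comparable with the total dimension of the homology. -/
lemma exists_mass_bounds (hσ : σ ∈ stabQuiver N) : ∃ c D : ℝ, 0 < c ∧ 0 < D ∧
    ∀ (E : Db l) (hE : ¬ IsZero E), c * size E ≤ σ.mass E hE ∧ σ.mass E hE ≤ D * size E := by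
  obtain ⟨c, hc, hb⟩ := exists_lower_bound (charge_simple hσ)
  set z : Fin 2 → ℂ := fun i => σ.Z (K0.cls (single 0 (simple l i))) with hz
  refine ⟨c, ‖z 0‖ + ‖z 1‖ + 1, hc, by positivity, fun E hE => ?_⟩
  obtain ⟨L, h⟩ := σ.exists_tower E
  have hsize : (size E : ℝ) = (L.map fun p => (size p.2 : ℝ)).sum := by
    have : size E = (L.map fun p => size p.2).sum := by
      simp only [size]
      rw [List.sum_map_add, ← total_tower hσ h, ← total_tower hσ h]
    rw [this, Nat.cast_list_sum, List.map_map]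
    rfl
  rw [mass_eq h hE, hsize, ← List.sum_map_mul_left, ← List.sum_map_mul_left]
  constructor
  · refine List.sum_le_sum fun p hp => ?_
    obtain ⟨h1, h2⟩ := h.mem p hp
    rw [norm_charge_semistable hσ h1 h2, size, Nat.cast_add]
    exact hb _ _ (Nat.cast_nonneg _) (Nat.cast_nonneg _)
  · refine List.sum_le_sum fun p hp => ?_
    obtain ⟨h1, h2⟩ := h.mem p hp
    rw [norm_charge_semistable hσ h1 h2, size, Nat.cast_add]
    refine (norm_add_le _ _).trans ?_
    rw [norm_mul, norm_mul, Complex.norm_real, Complex.norm_real, Real.norm_of_nonneg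
      (Nat.cast_nonneg _), Real.norm_of_nonneg (Nat.cast_nonneg _)]
    have h3 : (0 : ℝ) ≤ (dim l 0).total p.2 := Nat.cast_nonneg _
    have h4 : (0 : ℝ) ≤ (dim l 1).total p.2 := Nat.cast_nonneg _
    change _ * ‖z 0‖ + _ * ‖z 1‖ ≤ _
    nlinarith [norm_nonneg (z 0), norm_nonneg (z 1), mul_nonneg h3 (norm_nonneg (z 1)),
      mul_nonneg h4 (norm_nonneg (z 0))]

lemma abs_log_div_le {a b r : ℝ} (ha : 0 < a) (hb : 0 < b) (h1 : a ≤ Real.exp r * b)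
    (h2 : b ≤ Real.exp r * a) : |Real.log (a / b)| ≤ r := by
  rw [Real.log_div ha.ne' hb.ne', abs_le]
  have i1 := Real.log_le_log ha h1
  have i2 := Real.log_le_log hb h2
  rw [Real.log_mul (Real.exp_pos _).ne' hb.ne', Real.log_exp] at i1
  rw [Real.log_mul (Real.exp_pos _).ne' ha.ne', Real.log_exp] at i2
  constructor <;> linarith

/-- Two stability conditions whose heart is the category of modules are at finite distance. -/
lemma dB_ne_top_of_mem_stabQuiver (hσ : σ ∈ stabQuiver N) (hτ : τ ∈ stabQuiver N) :
    dB σ τ ≠ ⊤ := by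
  obtain ⟨c, D, hc, hD, hσm⟩ := exists_mass_bounds hσ
  obtain ⟨c', D', hc', hD', hτm⟩ := exists_mass_bounds hτ
  set K := max (D / c') (D' / c)
  have hK : 0 < K := lt_max_of_lt_left (by positivity)
  suffices h : dB σ τ ≤ ENNReal.ofReal (max 1 (Real.log K)) from
    (h.trans_lt ENNReal.ofReal_lt_top).ne
  refine iSup₂_le fun E hE => ENNReal.ofReal_le_ofReal ?_
  obtain ⟨L, hL⟩ := σ.exists_tower E
  obtain ⟨L', hL'⟩ := τ.exists_tower E
  have hphase : ∀ {σ τ : StabilityCondition N}, σ ∈ stabQuiver N → τ ∈ stabQuiver N →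
      ∀ {L L' : List (ℝ × Db l)}, HNTower σ.P L E → HNTower τ.P L' E →
      ∀ p ∈ L, ∃ q ∈ L', |p.1 - q.1| ≤ 1 := by
    intro σ τ hσ hτ L L' hL hL' p hp
    obtain ⟨q, hq, i, n, h1, h2⟩ := exists_mem_of_mem hσ hτ hL hL' hp
    have h3 := phase_mem_of_homology hσ (hL.mem p hp).1 h1
    have h4 := phase_mem_of_homology hτ (hL'.mem q hq).1 h2
    refine ⟨q, hq, ?_⟩
    rw [abs_le]
    constructor <;> linarith [h3.1, h3.2, h4.1, h4.2]
  obtain ⟨h1, h2⟩ := abs_phi_sub_le hL hL' hE (hphase hσ hτ hL hL') (hphase hτ hσ hL' hL)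
  refine max_le (le_max_of_le_left (max_le h1 h2)) (le_max_of_le_right ?_)
  refine abs_log_div_le (σ.mass_pos E hE) (τ.mass_pos E hE) ?_ ?_
  · rw [Real.exp_log hK]
    calc σ.mass E hE ≤ D * size E := (hσm E hE).2
      _ = D / c' * (c' * size E) := by field_simp
      _ ≤ K * τ.mass E hE := mul_le_mul (le_max_left _ _) (hτm E hE).1 (by positivity) hK.le
  · rw [Real.exp_log hK]
    calc τ.mass E hE ≤ D' * size E := (hτm E hE).2
      _ = D' / c * (c * size E) := by field_simp
      _ ≤ K * σ.mass E hE := mul_le_mul (le_max_right _ _) (hσm E hE).1 (by positivity) hK.le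

lemma dB_ne_top_of_mem_stabDagger (hσ : σ ∈ stabDagger N) (hτ : τ ∈ stabDagger N) :
    dB σ τ ≠ ⊤ := by
  obtain ⟨σ', hσ', h1⟩ := hσ
  obtain ⟨τ', hτ', h2⟩ := hτ
  have h3 := dB_ne_top_of_mem_connectedComponent h1
  have h4 := dB_ne_top_of_mem_connectedComponent h2
  rw [dB_comm] at h4
  refine ne_top_of_le_ne_top (ENNReal.add_ne_top.2 ⟨ENNReal.add_ne_top.2
    ⟨h3, dB_ne_top_of_mem_stabQuiver hσ' hτ'⟩, h4⟩) ((dB_triangle _ τ' _).trans ?_)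
  exact add_le_add (dB_triangle _ _ _) le_rfl

lemma stabQuiver_subset_stabDagger : stabQuiver N ⊆ stabDagger N :=
  fun σ hσ => ⟨σ, hσ, mem_connectedComponent⟩

variable (N) in
/-- The metric on the quotient of the distinguished component by the action of `ℂ`. -/
noncomputable abbrev orbitMetricSpace : MetricSpace (StabDaggerModC N) :=
  letI := orbitEMetricSpace (stabDagger N)
  EMetricSpace.toMetricSpace (α := Quotient (orbitSetoid (stabDagger N))) (by
    rintro ⟨σ⟩ ⟨τ⟩
    exact ne_top_of_le_ne_top (dB_ne_top_of_mem_stabDagger σ.2 τ.2) (dBbar_le_dB _ _))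

end Kronecker

/-! ### A region of the quotient that is isometric to a strip with the supremum metric -/

namespace Kronecker

open Bridgeland StabilityCondition

variable {l : ℕ} [HasDerivedCategory.{w} (KroneckerMod l)]
  (N : Seminorm ℝ (ℝ ⊗[ℤ] K0 (Db l)))

lemma norm_charge_vertexStability {ph ms : Fin 2 → ℝ} (h01 : ph 0 < ph 1) (h10 : ph 1 < ph 0 + 1)
    (hms : ∀ i, 0 < ms i) {φ : ℝ} {A : Db l} (hA : vertexSlice ph φ A) (h0 : ¬ IsZero A) :
    ‖(vertexStability N ph ms h01 h10 hms).Z (K0.cls A)‖ =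
      ∑ i, ms i * (dim l i).total A := by
  obtain ⟨i, n, -, hin, hsupp⟩ := vertexSlice_support h01 h10 hA h0
  have e : Complex.I * Real.pi * ph i = ((Real.pi * ph i : ℝ) : ℂ) * Complex.I := by
    push_cast; ring
  change ‖charge (fun i => ms i * Complex.exp (Complex.I * Real.pi * ph i)) (K0.cls A)‖ = _
  rw [charge_cls, sum_euler hsupp (fun k j => (k : ℂ) *
      (ms j * Complex.exp (Complex.I * Real.pi * ph j))) (by simp), norm_mul, norm_mul, e,
    Complex.norm_exp_ofReal_mul_I, mul_one, Complex.norm_real, Real.norm_of_nonneg (hms i).le,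
    Int.cast_mul, norm_mul, norm_negOnePow, one_mul, Finset.sum_eq_single i]
  · rw [(dim l i).total_eq_single fun m hm => hsupp i m (Or.inr hm)]
    simp [mul_comm]
  · intro j _ hj
    rw [(dim l j).total_eq_single (n := n) fun m hm => hsupp j m (Or.inr hm),
      hsupp j n (Or.inl hj)]
    simp
  · simp

/-- The sign with which the coordinates of the strip enter at a vertex. -/
def vertexSign : Fin 2 → ℝ := ![-1, 1]

lemma abs_vertexSign (i : Fin 2) : |vertexSign i| = 1 := by
  fin_cases i <;> simp [vertexSign]

/-- The point `(x, y)` of the strip: the simple modules have the phases `(1 ∓ x) / 2` and the masses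
`exp (∓ y / 2)`, so that `x` is the difference of the phases and `y` that of the logarithms of the
masses. This normalization makes the translation by `0` optimal for any two points. -/
noncomputable def stripPoint (x : Set.Ioo (0 : ℝ) 1) (y : ℝ) : StabilityCondition N :=
  vertexStability N (fun i => (1 + vertexSign i * x) / 2) (fun i => Real.exp (vertexSign i * y / 2))
    (by have := x.2.1; simp only [vertexSign, Matrix.cons_val_zero, Matrix.cons_val_one]; linarith)
    (by have := x.2.2; simp only [vertexSign, Matrix.cons_val_zero, Matrix.cons_val_one]; linarith)
    (fun _ => Real.exp_pos _)

variable {N}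

lemma stripPoint_P {x : Set.Ioo (0 : ℝ) 1} {y φ : ℝ} {A : Db l} :
    (stripPoint N x y).P φ A ↔ vertexSlice (fun i => (1 + vertexSign i * x) / 2) φ A := Iff.rfl

lemma stripPoint_mem (x : Set.Ioo (0 : ℝ) 1) (y : ℝ) : stripPoint N x y ∈ stabQuiver N := by
  obtain ⟨x, hx0, hx1⟩ := x
  refine vertexStability_mem N _ _ _ _ _ ?_ ?_ <;>
    simp only [vertexSign, Matrix.cons_val_zero, Matrix.cons_val_one] <;> linarith

lemma mass_stripPoint (x : Set.Ioo (0 : ℝ) 1) (y : ℝ) {E : Db l} (hE : ¬ IsZero E) :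
    (stripPoint N x y).mass E hE =
      ∑ i, Real.exp (vertexSign i * y / 2) * (dim l i).total E := by
  obtain ⟨L, h⟩ := (stripPoint N x y).exists_tower E
  have e : L.map (fun p => ‖(stripPoint N x y).Z (K0.cls p.2)‖) =
      L.map fun p => ∑ i, Real.exp (vertexSign i * y / 2) * ((dim l i).total p.2 : ℝ) :=
    List.map_congr_left fun p hp =>
      norm_charge_vertexStability N _ _ _ (stripPoint_P.1 (h.mem p hp).1) (h.mem p hp).2
  rw [mass_eq h hE, e, Fin.sum_univ_two]
  simp only [Fin.sum_univ_two]
  rw [List.sum_map_add, List.sum_map_mul_left, List.sum_map_mul_left,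
    total_tower (stripPoint_mem x y) h, total_tower (stripPoint_mem x y) h, Nat.cast_list_sum,
    Nat.cast_list_sum, List.map_map, List.map_map]
  rfl

lemma exists_phase_stripPoint {x x' : Set.Ioo (0 : ℝ) 1} {y y' : ℝ} {L L' : List (ℝ × Db l)}
    {E : Db l} (hL : HNTower (stripPoint N x y).P L E) (hL' : HNTower (stripPoint N x' y').P L' E) :
    ∀ p ∈ L, ∃ q ∈ L', |p.1 - q.1| ≤ |(x : ℝ) - x'| / 2 := by
  intro p hp
  obtain ⟨q, hq, i, n, h1, h2⟩ := exists_mem_of_mem (stripPoint_mem x y) (stripPoint_mem x' y')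
    hL hL' hp
  refine ⟨q, hq, le_of_eq ?_⟩
  have h3 : p.1 = (1 + vertexSign i * x) / 2 - n := stripPoint_P.1 (hL.mem p hp).1 i n h1
  have h4 : q.1 = (1 + vertexSign i * x') / 2 - n := stripPoint_P.1 (hL'.mem q hq).1 i n h2
  rw [h3, h4, show (1 + vertexSign i * (x : ℝ)) / 2 - n - ((1 + vertexSign i * (x' : ℝ)) / 2 - n) =
    vertexSign i * ((x : ℝ) - x') / 2 by ring, abs_div, abs_mul, abs_vertexSign, one_mul,
    abs_of_pos (zero_lt_two' ℝ)]

lemma mass_stripPoint_le (x x' : Set.Ioo (0 : ℝ) 1) (y y' : ℝ) {E : Db l} (hE : ¬ IsZero E) :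
    (stripPoint N x y).mass E hE ≤
      Real.exp (|y - y'| / 2) * (stripPoint N x' y').mass E hE := by
  rw [mass_stripPoint, mass_stripPoint, Finset.mul_sum]
  refine Finset.sum_le_sum fun i _ => ?_
  rw [← mul_assoc, ← Real.exp_add]
  refine mul_le_mul_of_nonneg_right (Real.exp_le_exp.2 ?_) (Nat.cast_nonneg _)
  have h := le_abs_self (vertexSign i * (y - y'))
  rw [abs_mul, abs_vertexSign, one_mul] at h
  linarith

lemma dB_stripPoint_le (x x' : Set.Ioo (0 : ℝ) 1) (y y' : ℝ) :
    dB (stripPoint N x y) (stripPoint N x' y') ≤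
      ENNReal.ofReal (max (|(x : ℝ) - x'| / 2) (|y - y'| / 2)) := by
  refine iSup₂_le fun E hE => ENNReal.ofReal_le_ofReal ?_
  obtain ⟨L, hL⟩ := (stripPoint N x y).exists_tower E
  obtain ⟨L', hL'⟩ := (stripPoint N x' y').exists_tower E
  have h2 := exists_phase_stripPoint hL' hL
  rw [abs_sub_comm] at h2
  obtain ⟨h3, h4⟩ := abs_phi_sub_le hL hL' hE (exists_phase_stripPoint hL hL') h2
  have h5 := mass_stripPoint_le (N := N) x' x y' y hE
  rw [abs_sub_comm] at h5
  exact max_le_max (max_le h3 h4) (abs_log_div_le (mass_pos _ E hE) (mass_pos _ E hE)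
    (mass_stripPoint_le x x' y y' hE) h5)

lemma stripPoint_simple (x : Set.Ioo (0 : ℝ) 1) (y : ℝ) (i : Fin 2) :
    (stripPoint N x y).phiPlus _ (not_isZero_single_simple (l := l) i) = (1 + vertexSign i * x) / 2 ∧
      Real.log ((stripPoint N x y).mass _ (not_isZero_single_simple (l := l) i)) =
        vertexSign i * y / 2 := by
  have hdeg : ∀ j m, m ≠ 0 → (dim l j).homology m (single 0 (simple l i)) = 0 :=
    fun j m hm => homology_single_of_ne j hm _
  constructor
  · refine (phi_semistable (stripPoint_P.2 ?_) _).1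
    intro j m hjm
    obtain rfl : m = 0 := by
      by_contra hm
      exact hjm (hdeg j m hm)
    rw [homology_single, dim_simple] at hjm
    obtain rfl : j = i := by
      by_contra hj
      exact hjm (if_neg hj)
    simp
  · rw [mass_stripPoint, Finset.sum_eq_single i]
    · rw [(dim l i).total_eq_single (hdeg i), homology_single, dim_simple, if_pos rfl]
      simp
    · intro j _ hj
      rw [(dim l j).total_eq_single (hdeg j), homology_single, dim_simple, if_neg hj]
      simp
    · simp

/-- A translation moves the coordinates of the two simple modules by the same amount, whereas they
differ by opposite amounts. -/
lemma half_abs_le_max (a c : ℝ) :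
    |a| / 2 ≤ max |vertexSign 0 * a / 2 + c| |vertexSign 1 * a / 2 + c| := by
  simp only [vertexSign, Matrix.cons_val_zero, Matrix.cons_val_one]
  rcases abs_cases a with ⟨h, -⟩ | ⟨h, -⟩ <;> rw [h] <;> by_contra! H <;>
    obtain ⟨h1, h2⟩ := max_lt_iff.1 H <;> rw [abs_lt] at h1 h2 <;> linarith

/-- The strip with half of the supremum metric embeds isometrically into the quotient. -/
lemma dBbar_stripPoint (x x' : Set.Ioo (0 : ℝ) 1) (y y' : ℝ) :
    dBbar (stripPoint N x y) (stripPoint N x' y') =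
      ENNReal.ofReal (max (|(x : ℝ) - x'| / 2) (|y - y'| / 2)) := by
  refine le_antisymm ((dBbar_le_dB _ _).trans (dB_stripPoint_le x x' y y')) (le_iInf fun z => ?_)
  have h : ∀ i, ENNReal.ofReal (max |vertexSign i * ((x : ℝ) - x') / 2 + z.re|
      |vertexSign i * (y - y') / 2 + -(Real.pi * z.im)|) ≤
      dB (stripPoint N x y) ((stripPoint N x' y').act z) := by
    intro i
    refine le_trans (ENNReal.ofReal_le_ofReal ?_)
      (distTerm_le_dB _ _ (not_isZero_single_simple (l := l) i))
    obtain ⟨h1, h2⟩ := stripPoint_simple (N := N) x y i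
    obtain ⟨h3, h4⟩ := stripPoint_simple (N := N) x' y' i
    rw [distTerm_act, h1, h2, h3, h4]
    refine max_le (le_max_of_le_left (le_max_of_le_left (le_of_eq ?_)))
      (le_max_of_le_right (le_of_eq ?_)) <;> congr 1 <;> ring
  have h0 := h 0
  have h1 := h 1
  refine le_trans (ENNReal.ofReal_le_ofReal (q := max
    (max |vertexSign 0 * ((x : ℝ) - x') / 2 + z.re|
      |vertexSign 0 * (y - y') / 2 + -(Real.pi * z.im)|)
    (max |vertexSign 1 * ((x : ℝ) - x') / 2 + z.re|
      |vertexSign 1 * (y - y') / 2 + -(Real.pi * z.im)|)) ?_) ?_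
  · refine max_le ((half_abs_le_max _ z.re).trans ?_)
      ((half_abs_le_max _ (-(Real.pi * z.im))).trans ?_)
    · exact max_le_max (le_max_left _ _) (le_max_left _ _)
    · exact max_le_max (le_max_right _ _) (le_max_right _ _)
  · rw [ENNReal.ofReal_max (x := max |vertexSign 0 * ((x : ℝ) - x') / 2 + z.re| _)]
    exact max_le h0 h1

/-- The orbit of a point of the strip. -/
noncomputable def stripOrbit (N : Seminorm ℝ (ℝ ⊗[ℤ] K0 (Db l))) (x : Set.Ioo (0 : ℝ) 1) (y : ℝ) :
    StabDaggerModC N :=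
  orbit N ⟨stripPoint N x y, stabQuiver_subset_stabDagger (stripPoint_mem x y)⟩

lemma dist_stripOrbit (x x' : Set.Ioo (0 : ℝ) 1) (y y' : ℝ) :
    (orbitMetricSpace N).dist (stripOrbit N x y) (stripOrbit N x' y') =
      max (|(x : ℝ) - x'| / 2) (|y - y'| / 2) := by
  change (dBbar (stripPoint N x y) (stripPoint N x' y')).toReal = _
  rw [dBbar_stripPoint, ENNReal.toReal_ofReal (le_max_of_le_left (by positivity))]

/-- In the supremum metric every curve that moves at unit speed in one coordinate and at most as
fast in the other one is a geodesic. -/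
lemma isGeodesic_stripOrbit (x : ℝ → Set.Ioo (0 : ℝ) 1)
    (hx : ∀ s t, |(x s : ℝ) - x t| ≤ |s - t|) :
    letI := orbitMetricSpace N
    MetricGeometry.IsGeodesic (fun t => stripOrbit N (x t) t) (stripOrbit N (x 0) 0)
      (stripOrbit N (x 1) 1) := by
  have key : ∀ s t, (orbitMetricSpace N).dist (stripOrbit N (x s) s) (stripOrbit N (x t) t) =
      |s - t| / 2 := fun s t => by
    rw [dist_stripOrbit, max_eq_right (div_le_div_of_nonneg_right (hx s t) zero_le_two)]
  refine ⟨rfl, rfl, fun s _ t _ => ?_⟩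
  refine (key s t).trans ?_
  rw [key 0 1]
  norm_num
  ring

/-- The coordinate `x` along a geodesic of the strip that makes a detour. -/
noncomputable def tent (t : ℝ) : Set.Ioo (0 : ℝ) 1 :=
  ⟨1 / 2 + max 0 (min t (1 - t)) / 2, by
    have h1 : max 0 (min t (1 - t)) ≤ 1 / 2 := by
      refine max_le (by norm_num) ?_
      rcases le_total t (1 - t) with h | h
      · rw [min_eq_left h]; linarith
      · rw [min_eq_right h]; linarith
    have h2 : 0 ≤ max 0 (min t (1 - t)) := le_max_left _ _
    constructor <;> linarith⟩

lemma abs_tent_sub_le (s t : ℝ) : |(tent s : ℝ) - tent t| ≤ |s - t| := by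
  have h : |max 0 (min s (1 - s)) - max 0 (min t (1 - t))| ≤ |s - t| := by
    refine (abs_max_sub_max_le_max _ _ _ _).trans (max_le (by simp) ?_)
    refine (abs_min_sub_min_le_max _ _ _ _).trans (max_le le_rfl (le_of_eq ?_))
    rw [abs_sub_comm]
    congr 1; ring
  have e : (tent s : ℝ) - tent t = (max 0 (min s (1 - s)) - max 0 (min t (1 - t))) / 2 := by
    simp only [tent]; ring
  rw [e, abs_div, abs_of_pos (zero_lt_two' ℝ)]
  linarith [abs_nonneg (s - t)]

end Kronecker

/-- The function `inf_λ d_B(σ, τ.λ)` is a well-defined metric on the quotient by `ℂ` of the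
distinguished component of the space of stability conditions of the `l`-Kronecker quiver, and
this metric space is not CAT(0). -/
theorem theorem3p9 (l : ℕ) (hl : 0 < l) [HasDerivedCategory.{w} (KroneckerMod l)]
    (N : Seminorm ℝ (ℝ ⊗[ℤ] Bridgeland.K0 (Kronecker.Db l))) (hN : ∀ x, N x = 0 → x = 0) :
    ∃ _ : MetricSpace (Kronecker.StabDaggerModC N),
      (∀ σ τ : Kronecker.stabDagger N,
        edist (Kronecker.orbit N σ) (Kronecker.orbit N τ) =
          Bridgeland.StabilityCondition.dBbar σ.1 τ.1) ∧
      ¬ MetricGeometry.IsCAT0 (Kronecker.StabDaggerModC N) := by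
  let _ := Kronecker.orbitMetricSpace N
  refine ⟨Kronecker.orbitMetricSpace N, fun _ _ => rfl, ?_⟩
  let x₀ : Set.Ioo (0 : ℝ) 1 := ⟨1 / 2, by constructor <;> norm_num⟩
  have h1 := Kronecker.isGeodesic_stripOrbit (N := N) (fun _ => x₀) fun s t => by simp
  have h2 := Kronecker.isGeodesic_stripOrbit (N := N) Kronecker.tent Kronecker.abs_tent_sub_le
  have e0 : Kronecker.tent 0 = x₀ := Subtype.ext (by simp [Kronecker.tent, x₀])
  have e1 : Kronecker.tent 1 = x₀ := Subtype.ext (by simp [Kronecker.tent, x₀])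
  have eh : (Kronecker.tent (1 / 2) : ℝ) = 3 / 4 := by norm_num [Kronecker.tent]
  rw [e0, e1] at h2
  refine MetricGeometry.not_isCAT0_of_geodesics ?_ h1 h2 ?_
  · refine dist_pos.1 ?_
    refine lt_of_lt_of_eq ?_ (Kronecker.dist_stripOrbit _ _ _ _).symm
    norm_num
  · refine dist_pos.1 ?_
    refine lt_of_lt_of_eq ?_ (Kronecker.dist_stripOrbit _ _ _ _).symm
    rw [eh]
    norm_num [x₀]
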